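/- Let $\mathcal G\rightrightarrows M$ be a (smooth, finite-dimensional, real) Lie groupoid with source and target maps $\mathsf s,\mathsf t:\mathcal G\to M$ and multiplication $m:\mathcal G^{(2)}=\{(g,h)\in\mathcal G\times\mathcal G\mid \mathsf s(g)=\mathsf t(h)\}\to\mathcal G$. For a manifold $N$, let $\Omega^k(N,TN)=\Gamma(\wedge^kT^*N\otimes TN)$ be the space of smooth vector-valued $k$-forms on $N$, viewed as maps $\oplus^kTN\to TN$. For $k\ge 0$, let $\oplus^kT\mathcal G\rightrightarrows\oplus^kTM$ be the groupoid whose source, target and multiplication are $T\mathsf s$, $T\mathsf t$ and $Tm$ applied componentwise, where $T(\mathcal G^{(2)})$ is identified with $\{(X,Y)\in T\mathcal G\times T\mathcal G\mid T\mathsf s(X)=T\mathsf t(Y)\}$; for $k=1$ it is the tangent groupoid $T\mathcal G\rightrightarrows TM$. A form $K\in\Omega^k(\mathcal G,T\mathcal G)$ is called multiplicative if there is $K_M\in\Omega^k(M,TM)$ such that $K:\oplus^kT\mathcal G\to T\mathcal G$ is a groupoid morphism over $K_M:\oplus^kTM\to TM$, i.e. the pair $(K,K_M)$ commutes with the source and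 target maps and preserves multiplication. (a) If $K\in\Omega^1(\mathcal G,T\mathcal G)$ is multiplicative, then its Nijenhuis tensor $N_K\in\Omega^2(\mathcal G,T\mathcal G)$, given on vector fields by $$N_K(X,Y)=[KX,KY]-K\big([KX,Y]+[X,KY]\big)+K^2[X,Y],$$ is multiplicative. (b) If $K\in\Omega^1(\mathcal G,T\mathcal G)$ is a multiplicative projection, i.e. multiplicative with $K\circ K=K$, then its curvature $R_K\in\Omega^2(\mathcal G,T\mathcal G)$, given on vector fields by $$R_K(X,Y)=K\big([(\mathrm{Id}-K)X,(\mathrm{Id}-K)Y]\big),$$ satisfies $R_K=K\circ N_K$ and is multiplicative. -/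

import Mathlib

open Bundle Manifold VectorField Set
open scoped Manifold ContDiff Topology

noncomputable section

/-! ### Vector-valued forms -/

/-- `VForm E N k` is the space `Ω^k(N, TN)` of smooth sections of the bundle of alternating
`k`-linear maps `TN × ⋯ × TN → TN`, where `N` is a smooth manifold modelled on `E`. -/
structure VForm (E : Type*) [NormedAddCommGroup E] [NormedSpace ℝ E]
    (N : Type*) [TopologicalSpace N] [ChartedSpace E N] [IsManifold 𝓘(ℝ, E) ∞ N] (k : ℕ) where
  /-- the alternating map on each tangent space -/
  toFun : ∀ x : N, TangentSpace 𝓘(ℝ, E) x [⋀^Fin k]→L[ℝ] TangentSpace 𝓘(ℝ, E) x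
  smooth : ContMDiff 𝓘(ℝ, E) (𝓘(ℝ, E).prod 𝓘(ℝ, E [⋀^Fin k]→L[ℝ] E)) ∞
    (fun x ↦ TotalSpace.mk' (E [⋀^Fin k]→L[ℝ] E)
      (E := fun x : N ↦ TangentSpace 𝓘(ℝ, E) x [⋀^Fin k]→L[ℝ] TangentSpace 𝓘(ℝ, E) x) x (toFun x))

namespace VForm

theorem contMDiffAt_alternating {E : Type*} [NormedAddCommGroup E] [NormedSpace ℝ E]
    [FiniteDimensional ℝ E] {N : Type*} [TopologicalSpace N] [ChartedSpace E N] {k : ℕ}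
    {f : N → E [⋀^Fin k]→L[ℝ] E} {x₀ : N}
    (h : ∀ m : Fin k → E, ContMDiffAt 𝓘(ℝ, E) 𝓘(ℝ, E) ∞ (fun x ↦ f x m) x₀) :
    ContMDiffAt 𝓘(ℝ, E) 𝓘(ℝ, E [⋀^Fin k]→L[ℝ] E) ∞ f x₀ := by
  let b := Module.finBasis ℝ E
  let L : (E [⋀^Fin k]→L[ℝ] E) →ₗ[ℝ] ((Fin k → Fin (Module.finrank ℝ E)) → E) :=
    { toFun := fun A j ↦ A fun i ↦ b (j i)
      map_add' := fun _ _ ↦ rfl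
      map_smul' := fun _ _ ↦ rfl }
  have hL : Function.Injective L := fun A B hAB ↦
    ContinuousAlternatingMap.toAlternatingMap_injective
      (b.ext_alternating fun j _ ↦ congrFun hAB j)
  obtain ⟨g, hg⟩ := L.exists_leftInverse_of_injective (LinearMap.ker_eq_bot.2 hL)
  have hfg : f = fun x ↦ g.toContinuousLinearMap (L (f x)) :=
    funext fun x ↦ (LinearMap.congr_fun hg (f x)).symm
  rw [hfg]
  exact g.toContinuousLinearMap.contDiff.contMDiff.contMDiffAt.comp x₀
    (contMDiffAt_pi_space.2 fun j ↦ h _)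

section

variable {E : Type*} [NormedAddCommGroup E] [NormedSpace ℝ E]
  {N : Type*} [TopologicalSpace N] [ChartedSpace E N] [IsManifold 𝓘(ℝ, E) ∞ N]

/-- A vector-valued `1`-form, seen as an endomorphism of the tangent bundle. -/
def endo (K : VForm E N 1) (x : N) : TangentSpace 𝓘(ℝ, E) x →L[ℝ] TangentSpace 𝓘(ℝ, E) x :=
  (ContinuousAlternatingMap.ofSubsingleton ℝ (TangentSpace 𝓘(ℝ, E) x)
    (TangentSpace 𝓘(ℝ, E) x) (0 : Fin 1)).symm (K.toFun x)

theorem endo_apply (K : VForm E N 1) (x : N) (v : TangentSpace 𝓘(ℝ, E) x) :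
    K.endo x v = K.toFun x (fun _ ↦ v) := rfl

/-- The action of a vector-valued `1`-form on vector fields. -/
def app (K : VForm E N 1) (X : ∀ x : N, TangentSpace 𝓘(ℝ, E) x) :
    ∀ x : N, TangentSpace 𝓘(ℝ, E) x := fun x ↦ K.endo x (X x)

theorem contMDiff_endo (K : VForm E N 1) :
    ContMDiff 𝓘(ℝ, E) (𝓘(ℝ, E).prod 𝓘(ℝ, E →L[ℝ] E)) ∞
      (fun x ↦ TotalSpace.mk' (E →L[ℝ] E)
        (E := fun x : N ↦ TangentSpace 𝓘(ℝ, E) x →L[ℝ] TangentSpace 𝓘(ℝ, E) x) x (K.endo x)) := by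
  intro x₀
  have h := (contMDiffAt_section x₀).1 (K.smooth x₀)
  rw [contMDiffAt_hom_bundle]
  refine ⟨contMDiffAt_id, ?_⟩
  exact (ContinuousAlternatingMap.ofSubsingletonLIE (𝕜 := ℝ) (E := E) (F := E)
    (0 : Fin 1)).symm.contDiff.contMDiff.contMDiffAt.comp x₀ h

theorem contMDiffAt_app (K : VForm E N 1) {X : ∀ x : N, TangentSpace 𝓘(ℝ, E) x} {x : N}
    (hX : ContMDiffAt 𝓘(ℝ, E) (𝓘(ℝ, E).prod 𝓘(ℝ, E)) ∞ (fun y ↦ TotalSpace.mk' E y (X y)) x) :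
    ContMDiffAt 𝓘(ℝ, E) (𝓘(ℝ, E).prod 𝓘(ℝ, E)) ∞ (fun y ↦ TotalSpace.mk' E y (K.app X y)) x :=
  (K.contMDiff_endo x).clm_bundle_apply hX

theorem mdifferentiableAt_app (K : VForm E N 1) {X : ∀ x : N, TangentSpace 𝓘(ℝ, E) x} {x : N}
    (hX : MDiffAt (T% X) x) : MDiffAt (T% (K.app X)) x :=
  ((K.contMDiff_endo x).mdifferentiableAt (by simp)).clm_bundle_apply hX

theorem app_add (K : VForm E N 1) (X Y : ∀ x : N, TangentSpace 𝓘(ℝ, E) x) :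
    K.app (X + Y) = K.app X + K.app Y := funext fun x ↦ (K.endo x).map_add _ _

theorem app_sub (K : VForm E N 1) (X Y : ∀ x : N, TangentSpace 𝓘(ℝ, E) x) :
    K.app (X - Y) = K.app X - K.app Y := funext fun x ↦ (K.endo x).map_sub _ _

theorem app_smul (K : VForm E N 1) (f : N → ℝ) (X : ∀ x : N, TangentSpace 𝓘(ℝ, E) x) :
    K.app (f • X) = f • K.app X := funext fun x ↦ (K.endo x).map_smul _ _

/-- The alternating map attached to a bilinear map that vanishes on the diagonal. -/
def altOfBilin {x : N}
    (B : TangentSpace 𝓘(ℝ, E) x →L[ℝ] TangentSpace 𝓘(ℝ, E) x →L[ℝ] TangentSpace 𝓘(ℝ, E) x)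
    (hB : ∀ v, B v v = 0) :
    TangentSpace 𝓘(ℝ, E) x [⋀^Fin 2]→L[ℝ] TangentSpace 𝓘(ℝ, E) x where
  toFun m := B (m 0) (m 1)
  map_update_add' := by
    intro _ m i u v
    fin_cases i <;> simp [Function.update]
  map_update_smul' := by
    intro _ m i c v
    fin_cases i <;> simp [Function.update]
  map_eq_zero_of_eq' := by
    intro m i j h hij
    fin_cases i <;> fin_cases j <;> simp_all
  cont := by
    have h : Continuous fun m : Fin 2 → E ↦ (show E →L[ℝ] E →L[ℝ] E from B) (m 0) (m 1) := by
      fun_prop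
    exact h

variable [FiniteDimensional ℝ E]

/-- A field of alternating maps that sends smooth vector fields to smooth vector fields is
smooth. -/
theorem contMDiff_of_apply {k : ℕ}
    (A : ∀ x : N, TangentSpace 𝓘(ℝ, E) x [⋀^Fin k]→L[ℝ] TangentSpace 𝓘(ℝ, E) x)
    (h : ∀ (X : Fin k → ∀ x : N, TangentSpace 𝓘(ℝ, E) x) (x₀ : N),
      (∀ i, CMDiffAt ∞ (T% (X i)) x₀) → CMDiffAt ∞ (T% (fun x ↦ A x fun i ↦ X i x)) x₀) :
    ContMDiff 𝓘(ℝ, E) (𝓘(ℝ, E).prod 𝓘(ℝ, E [⋀^Fin k]→L[ℝ] E)) ∞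
      (fun x ↦ TotalSpace.mk' (E [⋀^Fin k]→L[ℝ] E)
        (E := fun x : N ↦ TangentSpace 𝓘(ℝ, E) x [⋀^Fin k]→L[ℝ] TangentSpace 𝓘(ℝ, E) x)
        x (A x)) := by
  intro x₀
  rw [contMDiffAt_section]
  refine contMDiffAt_alternating fun m ↦ ?_
  let e := trivializationAt E (TangentSpace 𝓘(ℝ, E) : N → Type _) x₀
  have he : x₀ ∈ e.baseSet := FiberBundle.mem_baseSet_trivializationAt' x₀
  have hX : ∀ i, CMDiffAt ∞ (T% (fun x ↦ e.symmL ℝ x (m i))) x₀ := fun i ↦ by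
    rw [contMDiffAt_section]
    refine (contMDiffAt_const (c := m i)).congr_of_eventuallyEq ?_
    filter_upwards [e.open_baseSet.mem_nhds he] with x hx
    exact (e.continuousLinearMapAt_apply_of_mem (R := ℝ) hx _).symm.trans
      (e.continuousLinearMapAt_symmL (R := ℝ) hx (m i))
  have := (contMDiffAt_section x₀).1 (h _ x₀ hX)
  refine this.congr_of_eventuallyEq ?_
  filter_upwards [e.open_baseSet.mem_nhds he] with x hx
  exact e.continuousLinearMapAt_apply_of_mem (R := ℝ) hx _

/-- A bilinear operation on vector fields that is tensorial in both arguments, alternating and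
preserves smoothness is (the action on vector fields of) a vector-valued `2`-form. -/
def ofTensorial
    (Φ : (∀ x : N, TangentSpace 𝓘(ℝ, E) x) → (∀ x : N, TangentSpace 𝓘(ℝ, E) x) →
      ∀ x : N, TangentSpace 𝓘(ℝ, E) x)
    (h₁ : ∀ x (Y : ∀ x : N, TangentSpace 𝓘(ℝ, E) x), MDiffAt (T% Y) x →
      TensorialAt 𝓘(ℝ, E) E (fun X ↦ Φ X Y x) x)
    (h₂ : ∀ x (X : ∀ x : N, TangentSpace 𝓘(ℝ, E) x), MDiffAt (T% X) x →
      TensorialAt 𝓘(ℝ, E) E (fun Y ↦ Φ X Y x) x)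
    (h₀ : ∀ X x, Φ X X x = 0)
    (hs : ∀ (X Y : ∀ x : N, TangentSpace 𝓘(ℝ, E) x) (x : N), CMDiffAt ∞ (T% X) x →
      CMDiffAt ∞ (T% Y) x → CMDiffAt ∞ (T% (Φ X Y)) x) :
    VForm E N 2 where
  toFun x := altOfBilin (TensorialAt.mkHom₂ (fun X Y ↦ Φ X Y x) x (h₁ x) (h₂ x))
    (fun v ↦ h₀ _ x)
  smooth := contMDiff_of_apply _ fun X x₀ hX ↦ by
    refine (hs (X 0) (X 1) x₀ (hX 0) (hX 1)).congr_of_eventuallyEq ?_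
    have h : ∀ i, ∀ᶠ x in 𝓝 x₀, MDiffAt (T% (X i)) x := fun i ↦ by
      have h1 := (hX i).of_le (m := 1) (by simp)
      filter_upwards [(contMDiffAt_iff_contMDiffAt_nhds (by simp)).1 h1] with x hx
      exact hx.mdifferentiableAt one_ne_zero
    filter_upwards [h 0, h 1] with x h0 h1
    exact congrArg (TotalSpace.mk' E x) (TensorialAt.mkHom₂_apply (h₁ x) (h₂ x) h0 h1)

theorem ofTensorial_apply
    (Φ : (∀ x : N, TangentSpace 𝓘(ℝ, E) x) → (∀ x : N, TangentSpace 𝓘(ℝ, E) x) →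
      ∀ x : N, TangentSpace 𝓘(ℝ, E) x) (h₁ h₂ h₀ hs)
    {X Y : ∀ x : N, TangentSpace 𝓘(ℝ, E) x} {x : N} (hX : MDiffAt (T% X) x)
    (hY : MDiffAt (T% Y) x) :
    (ofTensorial Φ h₁ h₂ h₀ hs).toFun x ![X x, Y x] = Φ X Y x :=
  TensorialAt.mkHom₂_apply (h₁ x) (h₂ x) hX hY

theorem contMDiffAt_bracket {X Y : ∀ x : N, TangentSpace 𝓘(ℝ, E) x} {x : N}
    (hX : CMDiffAt ∞ (T% X) x) (hY : CMDiffAt ∞ (T% Y) x) :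
    CMDiffAt ∞ (T% (mlieBracket 𝓘(ℝ, E) X Y)) x := by
  have : IsManifold 𝓘(ℝ, E) (((⊤ : ℕ∞) : ℕ∞ω) + 1) N := by simpa
  have : IsManifold 𝓘(ℝ, E) (minSmoothness ℝ 2) N := by simp; infer_instance
  exact ContMDiffAt.mlieBracket_vectorField (m := ⊤) (n := ⊤) hX hY (by simp)

/-- The Nijenhuis tensor of `K`, i.e. the vector-valued `2`-form `N_K` with
`N_K(X, Y) = [KX, KY] - K([KX, Y] + [X, KY]) + K²[X, Y]` for all vector fields `X`, `Y`. -/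
def nijenhuis (K : VForm E N 1) : VForm E N 2 :=
  ofTensorial
    (fun X Y ↦ mlieBracket 𝓘(ℝ, E) (K.app X) (K.app Y)
      - K.app (mlieBracket 𝓘(ℝ, E) (K.app X) Y + mlieBracket 𝓘(ℝ, E) X (K.app Y))
      + K.app (K.app (mlieBracket 𝓘(ℝ, E) X Y)))
    (fun x Y hY ↦
      { smul := fun {f X} hf hX ↦ by
          have hKX := K.mdifferentiableAt_app hX
          simp only [app_smul, app, Pi.add_apply, Pi.sub_apply]
          rw [mlieBracket_smul_left hf hKX, mlieBracket_smul_left hf hKX,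
            mlieBracket_smul_left hf hX, mlieBracket_smul_left hf hX]
          simp [app]
          module
        add := fun {X X'} hX hX' ↦ by
          have hKX := K.mdifferentiableAt_app hX
          have hKX' := K.mdifferentiableAt_app hX'
          simp only [app_add, app, Pi.add_apply, Pi.sub_apply]
          rw [mlieBracket_add_left hKX hKX', mlieBracket_add_left hKX hKX',
            mlieBracket_add_left hX hX', mlieBracket_add_left hX hX']
          simp
          module })
    (fun x X hX ↦
      { smul := fun {f Y} hf hY ↦ by
          have hKY := K.mdifferentiableAt_app hY
          simp only [app_smul, app, Pi.add_apply, Pi.sub_apply]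
          rw [mlieBracket_smul_right hf hKY, mlieBracket_smul_right hf hKY,
            mlieBracket_smul_right hf hY, mlieBracket_smul_right hf hY]
          simp [app]
          module
        add := fun {Y Y'} hY hY' ↦ by
          have hKY := K.mdifferentiableAt_app hY
          have hKY' := K.mdifferentiableAt_app hY'
          simp only [app_add, app, Pi.add_apply, Pi.sub_apply]
          rw [mlieBracket_add_right hKY hKY', mlieBracket_add_right hKY hKY',
            mlieBracket_add_right hY hY', mlieBracket_add_right hY hY']
          simp
          module })
    (fun X x ↦ by
      have h := mlieBracket_swap_apply (I := 𝓘(ℝ, E)) (V := X) (W := K.app X) (x := x)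
      simp [app] at h ⊢
      simp [h])
    (fun X Y x hX hY ↦ by
      have hKX := K.contMDiffAt_app hX
      have hKY := K.contMDiffAt_app hY
      exact ((contMDiffAt_bracket hKX hKY).sub_section (K.contMDiffAt_app
        ((contMDiffAt_bracket hKX hY).add_section (contMDiffAt_bracket hX hKY)))).add_section
        (K.contMDiffAt_app (K.contMDiffAt_app (contMDiffAt_bracket hX hY))))

theorem nijenhuis_apply (K : VForm E N 1) {X Y : ∀ x : N, TangentSpace 𝓘(ℝ, E) x} {x : N}
    (hX : MDiffAt (T% X) x) (hY : MDiffAt (T% Y) x) :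
    K.nijenhuis.toFun x ![X x, Y x] =
      mlieBracket 𝓘(ℝ, E) (K.app X) (K.app Y) x
        - K.endo x (mlieBracket 𝓘(ℝ, E) (K.app X) Y x + mlieBracket 𝓘(ℝ, E) X (K.app Y) x)
        + K.endo x (K.endo x (mlieBracket 𝓘(ℝ, E) X Y x)) :=
  ofTensorial_apply _ _ _ _ _ hX hY

/-- `K` is a projection: `K ∘ K = K`. -/
def IsProjection (K : VForm E N 1) : Prop :=
  ∀ x, (K.endo x).comp (K.endo x) = K.endo x

/-- The curvature of a projection `K`, i.e. the vector-valued `2`-form `R_K` with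
`R_K(X, Y) = K [(Id - K) X, (Id - K) Y]` for all vector fields `X`, `Y`. -/
def curvature (K : VForm E N 1) (hK : K.IsProjection) : VForm E N 2 :=
  ofTensorial
    (fun X Y ↦ K.app (mlieBracket 𝓘(ℝ, E) (X - K.app X) (Y - K.app Y)))
    (fun x Y hY ↦
      { smul := fun {f X} hf hX ↦ by
          have hPX := mdifferentiableAt_sub_section hX (K.mdifferentiableAt_app hX)
          have h := DFunLike.congr_fun (hK x) (X x)
          simp only [app_smul, ← smul_sub]
          rw [app, mlieBracket_smul_left hf hPX]
          simp_all [app]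
        add := fun {X X'} hX hX' ↦ by
          have hPX := mdifferentiableAt_sub_section hX (K.mdifferentiableAt_app hX)
          have hPX' := mdifferentiableAt_sub_section hX' (K.mdifferentiableAt_app hX')
          simp only [app_add, add_sub_add_comm]
          rw [app, mlieBracket_add_left hPX hPX']
          simp [app] })
    (fun x X hX ↦
      { smul := fun {f Y} hf hY ↦ by
          have hPY := mdifferentiableAt_sub_section hY (K.mdifferentiableAt_app hY)
          have h := DFunLike.congr_fun (hK x) (Y x)
          simp only [app_smul, ← smul_sub]
          rw [app, mlieBracket_smul_right hf hPY]
          simp_all [app]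
        add := fun {Y Y'} hY hY' ↦ by
          have hPY := mdifferentiableAt_sub_section hY (K.mdifferentiableAt_app hY)
          have hPY' := mdifferentiableAt_sub_section hY' (K.mdifferentiableAt_app hY')
          simp only [app_add, add_sub_add_comm]
          rw [app, mlieBracket_add_right hPY hPY']
          simp [app] })
    (fun X x ↦ by simp [app])
    (fun X Y x hX hY ↦ K.contMDiffAt_app (contMDiffAt_bracket
      (hX.sub_section (K.contMDiffAt_app hX)) (hY.sub_section (K.contMDiffAt_app hY))))

theorem curvature_apply (K : VForm E N 1) (hK : K.IsProjection)
    {X Y : ∀ x : N, TangentSpace 𝓘(ℝ, E) x} {x : N}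
    (hX : MDiffAt (T% X) x) (hY : MDiffAt (T% Y) x) :
    (K.curvature hK).toFun x ![X x, Y x] =
      K.endo x (mlieBracket 𝓘(ℝ, E) (X - K.app X) (Y - K.app Y) x) :=
  ofTensorial_apply _ _ _ _ _ hX hY

end

/-- A vector-valued `k`-form on `N`, seen as a map `⊕^k TN → TN`. -/
def toMap {E : Type*} [NormedAddCommGroup E] [NormedSpace ℝ E]
    {N : Type*} [TopologicalSpace N] [ChartedSpace E N] [IsManifold 𝓘(ℝ, E) ∞ N] {k : ℕ}
    (K : VForm E N k) (p : Σ x : N, Fin k → TangentSpace 𝓘(ℝ, E) x) : TangentBundle 𝓘(ℝ, E) N :=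
  ⟨p.1, K.toFun p.1 p.2⟩

end VForm

/-! ### Lie groupoids -/

/-- The source, target and multiplication maps of a groupoid with arrows `A` and objects `O`.
Only the values of `mul` on composable pairs, `source a = target b`, are meaningful. -/
structure GroupoidMaps (A O : Type*) where
  /-- the source map -/
  source : A → O
  /-- the target map -/
  target : A → O
  /-- the multiplication, a junk value on pairs that are not composable -/
  mul : A → A → A

/-- The pair `(F, f)` commutes with source and target maps and preserves multiplication. -/
structure GroupoidMaps.IsMorphism {A O B P : Type*} (𝒢 : GroupoidMaps A O)
    (ℋ : GroupoidMaps B P) (F : A → B) (f : O → P) : Prop where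
  source_comm : ∀ a, ℋ.source (F a) = f (𝒢.source a)
  target_comm : ∀ a, ℋ.target (F a) = f (𝒢.target a)
  map_mul : ∀ a b, 𝒢.source a = 𝒢.target b → F (𝒢.mul a b) = ℋ.mul (F a) (F b)

/-- A Lie groupoid `G ⇉ M`. The space of composable arrows is an embedded submanifold of `G × G`
because `source` and `target` are submersions; a map is smooth on an embedded submanifold if and
only if it is smooth on it as a subset of the ambient manifold, in the sense of `ContMDiffOn`. -/
structure LieGroupoid (E : Type*) [NormedAddCommGroup E] [NormedSpace ℝ E]
    (G : Type*) [TopologicalSpace G] [ChartedSpace E G]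
    (E' : Type*) [NormedAddCommGroup E'] [NormedSpace ℝ E']
    (M : Type*) [TopologicalSpace M] [ChartedSpace E' M] extends GroupoidMaps G M where
  /-- the unit map -/
  one : M → G
  /-- the inversion -/
  inv : G → G
  source_mul : ∀ g h, source g = target h → source (mul g h) = source h
  target_mul : ∀ g h, source g = target h → target (mul g h) = target g
  mul_assoc : ∀ g h k, source g = target h → source h = target k →
    mul (mul g h) k = mul g (mul h k)
  source_one : ∀ x, source (one x) = x
  target_one : ∀ x, target (one x) = x
  mul_one : ∀ g, mul g (one (source g)) = g
  one_mul : ∀ g, mul (one (target g)) g = g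
  source_inv : ∀ g, source (inv g) = target g
  target_inv : ∀ g, target (inv g) = source g
  mul_inv : ∀ g, mul g (inv g) = one (target g)
  inv_mul : ∀ g, mul (inv g) g = one (source g)
  submersion_source : IsSubmersion 𝓘(ℝ, E) 𝓘(ℝ, E') ∞ source
  submersion_target : IsSubmersion 𝓘(ℝ, E) 𝓘(ℝ, E') ∞ target
  smooth_mul : ContMDiffOn (𝓘(ℝ, E).prod 𝓘(ℝ, E)) 𝓘(ℝ, E) ∞ (fun p : G × G ↦ mul p.1 p.2)
    {p | source p.1 = target p.2}
  smooth_one : ContMDiff 𝓘(ℝ, E') 𝓘(ℝ, E) ∞ one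
  smooth_inv : ContMDiff 𝓘(ℝ, E) 𝓘(ℝ, E) ∞ inv

namespace LieGroupoid

variable {E : Type*} [NormedAddCommGroup E] [NormedSpace ℝ E]
  {G : Type*} [TopologicalSpace G] [ChartedSpace E G]
  {E' : Type*} [NormedAddCommGroup E'] [NormedSpace ℝ E']
  {M : Type*} [TopologicalSpace M] [ChartedSpace E' M]

/-- The set of composable arrows. -/
def composable (𝒢 : LieGroupoid E G E' M) : Set (G × G) := {p | 𝒢.source p.1 = 𝒢.target p.2}

/-- The tangent map `Tm (X, Y)` of the multiplication, for `X ∈ T_g G` and `Y ∈ T_h G`. When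
`(g, h)` is composable and `Ts X = Tt Y`, so that `(X, Y)` is tangent to the submanifold of
composable arrows, the value does not depend on the derivative within this set that
`mfderivWithin` selects; other pairs `(X, Y)` are not used. -/
def tangentMul (𝒢 : LieGroupoid E G E' M) (g h : G) (X : TangentSpace 𝓘(ℝ, E) g)
    (Y : TangentSpace 𝓘(ℝ, E) h) : TangentSpace 𝓘(ℝ, E) (𝒢.mul g h) :=
  mfderivWithin (𝓘(ℝ, E).prod 𝓘(ℝ, E)) 𝓘(ℝ, E) (fun p : G × G ↦ 𝒢.mul p.1 p.2) 𝒢.composable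
    (g, h) (X, Y)

/-- The tangent groupoid `TG ⇉ TM`. -/
def tangent (𝒢 : LieGroupoid E G E' M) :
    GroupoidMaps (TangentBundle 𝓘(ℝ, E) G) (TangentBundle 𝓘(ℝ, E') M) where
  source := tangentMap 𝓘(ℝ, E) 𝓘(ℝ, E') 𝒢.source
  target := tangentMap 𝓘(ℝ, E) 𝓘(ℝ, E') 𝒢.target
  mul v w := ⟨𝒢.mul v.1 w.1, 𝒢.tangentMul v.1 w.1 v.2 w.2⟩

/-- The groupoid `⊕^k TG ⇉ ⊕^k TM`, with structure maps defined componentwise. -/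
def tangentSum (𝒢 : LieGroupoid E G E' M) (k : ℕ) :
    GroupoidMaps (Σ g : G, Fin k → TangentSpace 𝓘(ℝ, E) g)
      (Σ x : M, Fin k → TangentSpace 𝓘(ℝ, E') x) where
  source p := ⟨𝒢.source p.1, fun i ↦ mfderiv 𝓘(ℝ, E) 𝓘(ℝ, E') 𝒢.source p.1 (p.2 i)⟩
  target p := ⟨𝒢.target p.1, fun i ↦ mfderiv 𝓘(ℝ, E) 𝓘(ℝ, E') 𝒢.target p.1 (p.2 i)⟩
  mul p q := ⟨𝒢.mul p.1 q.1, fun i ↦ 𝒢.tangentMul p.1 q.1 (p.2 i) (q.2 i)⟩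

/-- A vector-valued form `K` on the arrows is multiplicative if, for some vector-valued form `K_M`
on the objects, `K : ⊕^k TG → TG` is a groupoid morphism over `K_M : ⊕^k TM → TM`. -/
def IsMultiplicative [IsManifold 𝓘(ℝ, E) ∞ G] [IsManifold 𝓘(ℝ, E') ∞ M]
    (𝒢 : LieGroupoid E G E' M) {k : ℕ} (K : VForm E G k) : Prop :=
  ∃ K_M : VForm E' M k, (𝒢.tangentSum k).IsMorphism 𝒢.tangent K.toMap K_M.toMap

end LieGroupoid

end

/-!
The Nijenhuis tensor is natural: if `Tf ∘ A = B ∘ Tf` for two fields of endomorphisms `A` and `B`,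
then `Tf ∘ N_A = N_B ∘ (Tf × Tf)`. In a vector space `N_A` has a formula in terms of `A` and its
derivative, and naturality is the symmetry of the second derivative of `f`; charts carry it over
to manifolds. That `K` is multiplicative over `K_M` says that `K` and `K_M` are related in this
sense by the source and target maps, and that `m` relates the restriction of `K × K` to the
composable arrows to `K`. Since the composable arrows are a fibre product of submersions, they are
parametrized near any point by a vector space on which `K × K` becomes a field of endomorphisms
`A`; the two projections and `m` all relate `A` to `K`, so `N_A` computes both sides of the
multiplicativity of `N_K`. For a projection, `R_K = K ∘ N_K` is a composite of groupoid morphisms,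
over the curvature of `K_M`, which is a projection because `Ts` is surjective.
-/

section NijenhuisInVectorSpace

variable {F : Type*} [NormedAddCommGroup F] [NormedSpace ℝ F]
  {V : Type*} [NormedAddCommGroup V] [NormedSpace ℝ V]

/-- The Nijenhuis tensor at `z` of a field `A` of endomorphisms of a vector space. It is obtained
by evaluating `[Au, Av] - A([Au, v] + [u, Av]) + A²[u, v]` on the constant vector fields `u`, `v`,
for which `[u, v] = 0`. -/
noncomputable def nijenhuisTensor (A : F → F →L[ℝ] F) (z u v : F) : F :=
  fderiv ℝ A z (A z u) v - fderiv ℝ A z (A z v) u + A z (fderiv ℝ A z v u)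
    - A z (fderiv ℝ A z u v)

theorem lieBracket_eq_nijenhuisTensor {A : F → F →L[ℝ] F} {z : F} (hA : DifferentiableAt ℝ A z)
    (u v : F) :
    lieBracket ℝ (fun y ↦ A y u) (fun y ↦ A y v) z
        - (A z (lieBracket ℝ (fun y ↦ A y u) (fun _ ↦ v) z)
          + A z (lieBracket ℝ (fun _ ↦ u) (fun y ↦ A y v) z))
        + A z (A z (lieBracket ℝ (fun _ ↦ u) (fun _ ↦ v) z)) = nijenhuisTensor A z u v := by
  have fderiv_apply (c w : F) : fderiv ℝ (fun y ↦ A y c) z w = fderiv ℝ A z w c := by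
    simp [fderiv_clm_apply hA (differentiableAt_const c)]
  simp only [lieBracket, nijenhuisTensor, fderiv_apply, fderiv_fun_const, Pi.zero_apply,
    _root_.zero_apply, map_zero, map_neg, sub_zero, zero_sub]
  abel

theorem fderiv_fderiv_add_of_intertwines {f : F → V} {A : F → F →L[ℝ] F} {B : V → V →L[ℝ] V}
    {z : F} (hf : ContDiffAt ℝ 2 f z) (hA : DifferentiableAt ℝ A z)
    (hB : DifferentiableAt ℝ B (f z))
    (h : ∀ᶠ y in 𝓝 z, ∀ v, fderiv ℝ f y (A y v) = B (f y) (fderiv ℝ f y v)) (a b : F) :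
    fderiv ℝ (fderiv ℝ f) z a (A z b) + fderiv ℝ f z (fderiv ℝ A z a b) =
      fderiv ℝ B (f z) (fderiv ℝ f z a) (fderiv ℝ f z b)
        + B (f z) (fderiv ℝ (fderiv ℝ f) z a b) := by
  have hf' : HasFDerivAt (fderiv ℝ f) (fderiv ℝ (fderiv ℝ f) z) z :=
    ((hf.fderiv_right (m := 1) (by norm_num)).differentiableAt one_ne_zero).hasFDerivAt
  have hBf := hB.hasFDerivAt.comp z (hf.differentiableAt two_ne_zero).hasFDerivAt
  have left := hf'.clm_apply (hA.hasFDerivAt.clm_apply (hasFDerivAt_const b z))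
  have right := hBf.clm_apply (hf'.clm_apply (hasFDerivAt_const b z))
  have left_eq_right := (left.congr_of_eventuallyEq (h.mono fun y hy ↦ (hy b).symm)).unique right
  simpa [add_comm] using DFunLike.congr_fun left_eq_right a

theorem nijenhuisTensor_map {f : F → V} {A : F → F →L[ℝ] F} {B : V → V →L[ℝ] V} {z : F}
    (hf : ContDiffAt ℝ 2 f z) (hA : DifferentiableAt ℝ A z) (hB : DifferentiableAt ℝ B (f z))
    (h : ∀ᶠ y in 𝓝 z, ∀ v, fderiv ℝ f y (A y v) = B (f y) (fderiv ℝ f y v)) (u v : F) :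
    nijenhuisTensor B (f z) (fderiv ℝ f z u) (fderiv ℝ f z v) =
      fderiv ℝ f z (nijenhuisTensor A z u v) := by
  have hsymm : ∀ a b, fderiv ℝ (fderiv ℝ f) z a b = fderiv ℝ (fderiv ℝ f) z b a :=
    hf.isSymmSndFDerivAt (by simp)
  have hz := h.self_of_nhds
  have deriv_h := fderiv_fderiv_add_of_intertwines hf hA hB h
  have e₁ := deriv_h (A z u) v
  have e₂ := deriv_h (A z v) u
  have e₃ := congrArg (B (f z)) (deriv_h v u)
  have e₄ := congrArg (B (f z)) (deriv_h u v)
  rw [hsymm (A z u) (A z v), hsymm (A z u) v] at e₁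
  rw [hsymm (A z v) u] at e₂
  rw [hsymm u v] at e₄
  simp only [map_add, hz] at e₁ e₂ e₃ e₄
  simp only [nijenhuisTensor, map_add, map_sub, hz]
  linear_combination (norm := module) (-1 : ℝ) • e₁ + (1 : ℝ) • e₂ + (-1 : ℝ) • e₃ + (1 : ℝ) • e₄

end NijenhuisInVectorSpace

section RelatedEndomorphisms

variable {E : Type*} [NormedAddCommGroup E] [NormedSpace ℝ E]
  {N : Type*} [TopologicalSpace N] [ChartedSpace E N]
  {E' : Type*} [NormedAddCommGroup E'] [NormedSpace ℝ E']
  {N' : Type*} [TopologicalSpace N'] [ChartedSpace E' N']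
  {E'' : Type*} [NormedAddCommGroup E''] [NormedSpace ℝ E'']
  {N'' : Type*} [TopologicalSpace N''] [ChartedSpace E'' N'']

/-- Two fields of endomorphisms of tangent spaces are related by `f` near `x`: the differential of
`f` intertwines them at all points of a neighbourhood of `x`. -/
def EndoRelatedAt (f : N → N')
    (A : ∀ x : N, TangentSpace 𝓘(ℝ, E) x →L[ℝ] TangentSpace 𝓘(ℝ, E) x)
    (B : ∀ x : N', TangentSpace 𝓘(ℝ, E') x →L[ℝ] TangentSpace 𝓘(ℝ, E') x) (x : N) : Prop :=
  ∀ᶠ y in 𝓝 x, ∀ v : TangentSpace 𝓘(ℝ, E) y,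
    mfderiv 𝓘(ℝ, E) 𝓘(ℝ, E') f y (A y v) = B (f y) (mfderiv 𝓘(ℝ, E) 𝓘(ℝ, E') f y v)

theorem eventually_mdifferentiableAt [IsManifold 𝓘(ℝ, E) 1 N] [IsManifold 𝓘(ℝ, E') 1 N']
    {f : N → N'} {x : N} (hf : ContMDiffAt 𝓘(ℝ, E) 𝓘(ℝ, E') 1 f x) :
    ∀ᶠ y in 𝓝 x, MDifferentiableAt 𝓘(ℝ, E) 𝓘(ℝ, E') f y :=
  ((contMDiffAt_iff_contMDiffAt_nhds (by simp)).1 hf).mono fun _ hy ↦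
    hy.mdifferentiableAt one_ne_zero

theorem EndoRelatedAt.comp [IsManifold 𝓘(ℝ, E) 1 N] [IsManifold 𝓘(ℝ, E') 1 N']
    [IsManifold 𝓘(ℝ, E'') 1 N''] {f : N → N'} {g : N' → N''}
    {A : ∀ x : N, TangentSpace 𝓘(ℝ, E) x →L[ℝ] TangentSpace 𝓘(ℝ, E) x}
    {B : ∀ x : N', TangentSpace 𝓘(ℝ, E') x →L[ℝ] TangentSpace 𝓘(ℝ, E') x}
    {C : ∀ x : N'', TangentSpace 𝓘(ℝ, E'') x →L[ℝ] TangentSpace 𝓘(ℝ, E'') x} {x : N}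
    (hBC : EndoRelatedAt g B C (f x)) (hAB : EndoRelatedAt f A B x)
    (hg : ContMDiffAt 𝓘(ℝ, E') 𝓘(ℝ, E'') 1 g (f x)) (hf : ContMDiffAt 𝓘(ℝ, E) 𝓘(ℝ, E') 1 f x) :
    EndoRelatedAt (g ∘ f) A C x := by
  filter_upwards [hAB, hf.continuousAt.eventually hBC, eventually_mdifferentiableAt hf,
    hf.continuousAt.eventually (eventually_mdifferentiableAt hg)] with y hAB hBC hf hg v
  rw [mfderiv_comp_apply y hg hf, mfderiv_comp_apply y hg hf, hAB, hBC]
  rfl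

end RelatedEndomorphisms

section Charts

variable {E : Type*} [NormedAddCommGroup E] [NormedSpace ℝ E]
  {N : Type*} [TopologicalSpace N] [ChartedSpace E N] [IsManifold 𝓘(ℝ, E) 1 N]

theorem mfderiv_extChartAt_mfderiv_symm {x₀ : N} {y : E}
    (hy : y ∈ (extChartAt 𝓘(ℝ, E) x₀).target) (w : E) :
    mfderiv 𝓘(ℝ, E) 𝓘(ℝ, E) (extChartAt 𝓘(ℝ, E) x₀) ((extChartAt 𝓘(ℝ, E) x₀).symm y)
      (mfderiv 𝓘(ℝ, E) 𝓘(ℝ, E) (extChartAt 𝓘(ℝ, E) x₀).symm y w) = w := by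
  have h := mfderiv_extChartAt_comp_mfderivWithin_extChartAt_symm hy
  rw [𝓘(ℝ, E).range_eq_univ, mfderivWithin_univ] at h
  exact DFunLike.congr_fun h w

theorem mfderiv_symm_mfderiv_extChartAt {x₀ : N} {y : E}
    (hy : y ∈ (extChartAt 𝓘(ℝ, E) x₀).target)
    (v : TangentSpace 𝓘(ℝ, E) ((extChartAt 𝓘(ℝ, E) x₀).symm y)) :
    mfderiv 𝓘(ℝ, E) 𝓘(ℝ, E) (extChartAt 𝓘(ℝ, E) x₀).symm y
      (mfderiv 𝓘(ℝ, E) 𝓘(ℝ, E) (extChartAt 𝓘(ℝ, E) x₀) ((extChartAt 𝓘(ℝ, E) x₀).symm y) v) =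
        v := by
  have h := mfderivWithin_extChartAt_symm_comp_mfderiv_extChartAt hy
  rw [𝓘(ℝ, E).range_eq_univ, mfderivWithin_univ] at h
  exact DFunLike.congr_fun h v

end Charts

namespace VForm

section

variable {E : Type*} [NormedAddCommGroup E] [NormedSpace ℝ E]
  {N : Type*} [TopologicalSpace N] [ChartedSpace E N] [IsManifold 𝓘(ℝ, E) ∞ N]

/-- The field of endomorphisms of the model space that represents the `1`-form `K` in the
preferred chart at `x₀`. -/
noncomputable def inChart (K : VForm E N 1) (x₀ : N) (y : E) : E →L[ℝ] E :=
  (mfderiv 𝓘(ℝ, E) 𝓘(ℝ, E) (extChartAt 𝓘(ℝ, E) x₀) ((extChartAt 𝓘(ℝ, E) x₀).symm y)).comp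
    ((K.endo ((extChartAt 𝓘(ℝ, E) x₀).symm y)).comp
      (mfderiv 𝓘(ℝ, E) 𝓘(ℝ, E) (extChartAt 𝓘(ℝ, E) x₀).symm y))

theorem contDiffAt_inChart (K : VForm E N 1) (x₀ : N) :
    ContDiffAt ℝ ∞ (K.inChart x₀) (extChartAt 𝓘(ℝ, E) x₀ x₀) := by
  have hK := ((contMDiffAt_hom_bundle _).1 (K.contMDiff_endo x₀)).2
  have hχ := (contMDiffOn_extChartAt_symm (I := 𝓘(ℝ, E)) (n := ∞) x₀).contMDiffAt
    (extChartAt_target_mem_nhds x₀)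
  refine (hK.comp_of_eq hχ (extChartAt_to_inv x₀)).contDiffAt.congr_of_eventuallyEq ?_
  filter_upwards [extChartAt_target_mem_nhds (I := 𝓘(ℝ, E)) x₀] with y hy
  have hχy : (extChartAt 𝓘(ℝ, E) x₀).symm y ∈ (chartAt E x₀).source := by
    simpa only [extChartAt_source] using (extChartAt 𝓘(ℝ, E) x₀).map_target hy
  have hκ := TangentBundle.continuousLinearMapAt_trivializationAt (I := 𝓘(ℝ, E)) (𝕜 := ℝ) hχy
  have hχ := TangentBundle.symmL_trivializationAt (I := 𝓘(ℝ, E)) (𝕜 := ℝ) hχy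
  rw [(extChartAt 𝓘(ℝ, E) x₀).right_inv hy, 𝓘(ℝ, E).range_eq_univ, mfderivWithin_univ] at hχ
  rw [inChart, ← hκ, ← hχ]
  rfl

theorem endoRelatedAt_extChartAt_symm (K : VForm E N 1) {x₀ : N} {y : E}
    (hy : y ∈ (extChartAt 𝓘(ℝ, E) x₀).target) :
    EndoRelatedAt (extChartAt 𝓘(ℝ, E) x₀).symm (K.inChart x₀) K.endo y := by
  filter_upwards [(isOpen_extChartAt_target x₀).mem_nhds hy] with y hy v
  exact mfderiv_symm_mfderiv_extChartAt hy _

theorem endoRelatedAt_extChartAt (K : VForm E N 1) {x₀ x : N}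
    (hx : x ∈ (extChartAt 𝓘(ℝ, E) x₀).source) :
    EndoRelatedAt (extChartAt 𝓘(ℝ, E) x₀) K.endo (K.inChart x₀) x := by
  filter_upwards [(isOpen_extChartAt_source x₀).mem_nhds hx] with x hx v
  obtain ⟨y, hy, rfl⟩ := (extChartAt 𝓘(ℝ, E) x₀).symm.surjOn hx
  obtain ⟨w, rfl⟩ : ∃ w, mfderiv 𝓘(ℝ, E) 𝓘(ℝ, E) (extChartAt 𝓘(ℝ, E) x₀).symm y w = v :=
    ⟨_, mfderiv_symm_mfderiv_extChartAt hy v⟩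
  exact (congrArg₂ (fun y w ↦ K.inChart x₀ y w) ((extChartAt 𝓘(ℝ, E) x₀).right_inv hy)
    (mfderiv_extChartAt_mfderiv_symm hy w)).symm

end

end VForm

section ChartFields

variable {E : Type*} [NormedAddCommGroup E] [NormedSpace ℝ E]
  {N : Type*} [TopologicalSpace N] [ChartedSpace E N]

/-- The vector field that the preferred chart at `x₀` carries to the vector field `V` on the model
space; its values outside the chart domain are junk. -/
noncomputable def chartField (x₀ : N) (V : E → E) : ∀ x : N, TangentSpace 𝓘(ℝ, E) x :=
  mpullback 𝓘(ℝ, E) 𝓘(ℝ, E) (extChartAt 𝓘(ℝ, E) x₀) V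

theorem mfderiv_chartField [IsManifold 𝓘(ℝ, E) 1 N] {x₀ x : N}
    (hx : x ∈ (extChartAt 𝓘(ℝ, E) x₀).source) (V : E → E) :
    mfderiv 𝓘(ℝ, E) 𝓘(ℝ, E) (extChartAt 𝓘(ℝ, E) x₀) x (chartField x₀ V x) =
      V (extChartAt 𝓘(ℝ, E) x₀ x) :=
  (isInvertible_mfderiv_extChartAt hx).self_apply_inverse _

theorem exists_chartField_const_eq [IsManifold 𝓘(ℝ, E) 1 N] {x₀ : N}
    (v : TangentSpace 𝓘(ℝ, E) x₀) : ∃ c : E, chartField x₀ (fun _ ↦ c) x₀ = v :=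
  ⟨_, (isInvertible_mfderiv_extChartAt (mem_extChartAt_source x₀)).inverse_apply_self v⟩

theorem mdifferentiableAt_vectorSpace {V : ∀ y : E, TangentSpace 𝓘(ℝ, E) y} {y : E}
    (hV : DifferentiableAt ℝ (fun y ↦ (V y : E)) y) : MDiffAt (T% V) y := by
  refine (mdifferentiableAt_totalSpace _ _).2 ⟨mdifferentiableAt_id, ?_⟩
  convert! hV.mdifferentiableAt
  simp

theorem mlieBracket_vectorSpace (V W : E → E) :
    mlieBracket 𝓘(ℝ, E) (M := E) V W = lieBracket ℝ V W :=
  (mlieBracketWithin_univ.symm.trans mlieBracketWithin_eq_lieBracketWithin).trans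
    lieBracketWithin_univ

variable [CompleteSpace E] [IsManifold 𝓘(ℝ, E) 2 N]

theorem mdifferentiableAt_chartField (x₀ : N) {V : E → E}
    (hV : DifferentiableAt ℝ V (extChartAt 𝓘(ℝ, E) x₀ x₀)) : MDiffAt (T% (chartField x₀ V)) x₀ :=
  MDifferentiableAt.mpullback_vectorField (mdifferentiableAt_vectorSpace hV)
    (contMDiffAt_extChartAt (n := 2))
    (isInvertible_mfderiv_extChartAt (mem_extChartAt_source x₀)) le_rfl

theorem mfderiv_mlieBracket_eq_lieBracket {x₀ : N} {X Y : ∀ x : N, TangentSpace 𝓘(ℝ, E) x}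
    {V W : E → E} (hX : X =ᶠ[𝓝 x₀] chartField x₀ V) (hY : Y =ᶠ[𝓝 x₀] chartField x₀ W)
    (hV : DifferentiableAt ℝ V (extChartAt 𝓘(ℝ, E) x₀ x₀))
    (hW : DifferentiableAt ℝ W (extChartAt 𝓘(ℝ, E) x₀ x₀)) :
    mfderiv 𝓘(ℝ, E) 𝓘(ℝ, E) (extChartAt 𝓘(ℝ, E) x₀) x₀ (mlieBracket 𝓘(ℝ, E) X Y x₀) =
      lieBracket ℝ V W (extChartAt 𝓘(ℝ, E) x₀ x₀) := by
  have : IsManifold 𝓘(ℝ, E) (minSmoothness ℝ 2) N := by simpa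
  have pullback_bracket := mpullback_mlieBracket (mdifferentiableAt_vectorSpace hV)
    (mdifferentiableAt_vectorSpace hW)
    (contMDiffAt_extChartAt (I := 𝓘(ℝ, E)) (n := 2) (x := x₀)) (by simp)
  rw [mlieBracket_vectorSpace] at pullback_bracket
  rw [hX.mlieBracket_vectorField_eq hY, chartField, chartField, ← pullback_bracket]
  exact (isInvertible_mfderiv_extChartAt (mem_extChartAt_source x₀)).self_apply_inverse _

end ChartFields

namespace VForm

variable {E : Type*} [NormedAddCommGroup E] [NormedSpace ℝ E]
  {N : Type*} [TopologicalSpace N] [ChartedSpace E N] [IsManifold 𝓘(ℝ, E) ∞ N]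

theorem app_chartField (K : VForm E N 1) (x₀ : N) (V : E → E) :
    K.app (chartField x₀ V) =ᶠ[𝓝 x₀] chartField x₀ (fun y ↦ K.inChart x₀ y (V y)) := by
  filter_upwards [extChartAt_source_mem_nhds (I := 𝓘(ℝ, E)) x₀] with x hx
  refine ((isInvertible_mfderiv_extChartAt hx).inverse_apply_eq.2 ?_).symm
  have h := (K.endoRelatedAt_extChartAt hx).self_of_nhds (chartField x₀ V x)
  rw [mfderiv_chartField hx] at h
  exact h.symm

theorem mfderiv_nijenhuis [FiniteDimensional ℝ E] (K : VForm E N 1) (x₀ : N)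
    (v : Fin 2 → TangentSpace 𝓘(ℝ, E) x₀) :
    mfderiv 𝓘(ℝ, E) 𝓘(ℝ, E) (extChartAt 𝓘(ℝ, E) x₀) x₀ (K.nijenhuis.toFun x₀ v) =
      nijenhuisTensor (K.inChart x₀) (extChartAt 𝓘(ℝ, E) x₀ x₀)
        (mfderiv 𝓘(ℝ, E) 𝓘(ℝ, E) (extChartAt 𝓘(ℝ, E) x₀) x₀ (v 0))
        (mfderiv 𝓘(ℝ, E) 𝓘(ℝ, E) (extChartAt 𝓘(ℝ, E) x₀) x₀ (v 1)) := by
  obtain ⟨a, ha⟩ := exists_chartField_const_eq (v 0)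
  obtain ⟨b, hb⟩ := exists_chartField_const_eq (v 1)
  have hv : v = ![chartField x₀ (fun _ ↦ a) x₀, chartField x₀ (fun _ ↦ b) x₀] := by
    ext i; fin_cases i <;> simp [ha, hb]
  have hx₀ := mem_extChartAt_source (I := 𝓘(ℝ, E)) x₀
  have hB : DifferentiableAt ℝ (K.inChart x₀) (extChartAt 𝓘(ℝ, E) x₀ x₀) :=
    (K.contDiffAt_inChart x₀).differentiableAt (by simp)
  have const_diff (c : E) :
      DifferentiableAt ℝ (fun _ : E ↦ c) (extChartAt 𝓘(ℝ, E) x₀ x₀) := differentiableAt_const c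
  have app_diff (c : E) :
      DifferentiableAt ℝ (fun y ↦ K.inChart x₀ y c) (extChartAt 𝓘(ℝ, E) x₀ x₀) :=
    hB.clm_apply (const_diff c)
  have app_eq (c : E) := K.app_chartField x₀ (fun _ ↦ c)
  have related := (K.endoRelatedAt_extChartAt hx₀).self_of_nhds
  rw [← ha, ← hb, hv, K.nijenhuis_apply (mdifferentiableAt_chartField x₀ (const_diff a))
    (mdifferentiableAt_chartField x₀ (const_diff b))]
  simp only [map_add, map_sub, related, mfderiv_chartField hx₀,
    mfderiv_mlieBracket_eq_lieBracket (app_eq a) (app_eq b) (app_diff a) (app_diff b),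
    mfderiv_mlieBracket_eq_lieBracket (app_eq a) .rfl (app_diff a) (const_diff b),
    mfderiv_mlieBracket_eq_lieBracket .rfl (app_eq b) (const_diff a) (app_diff b),
    mfderiv_mlieBracket_eq_lieBracket .rfl .rfl (const_diff a) (const_diff b)]
  exact lieBracket_eq_nijenhuisTensor hB a b

end VForm

namespace VForm

variable {E : Type*} [NormedAddCommGroup E] [NormedSpace ℝ E] [FiniteDimensional ℝ E]
  {N : Type*} [TopologicalSpace N] [ChartedSpace E N] [IsManifold 𝓘(ℝ, E) ∞ N]

theorem mfderiv_nijenhuisTensor (K : VForm E N 1) {F : Type*} [NormedAddCommGroup F]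
    [NormedSpace ℝ F] {ψ : F → N} {A : F → F →L[ℝ] F} {z : F}
    (hψ : ContMDiffAt 𝓘(ℝ, F) 𝓘(ℝ, E) ∞ ψ z) (hA : DifferentiableAt ℝ A z)
    (h : EndoRelatedAt ψ A K.endo z) (v : Fin 2 → F) :
    mfderiv 𝓘(ℝ, F) 𝓘(ℝ, E) ψ z (nijenhuisTensor (F := F) A z (v 0) (v 1)) =
      K.nijenhuis.toFun (ψ z) (fun i ↦ mfderiv 𝓘(ℝ, F) 𝓘(ℝ, E) ψ z (v i)) := by
  have hκ : ContMDiffAt 𝓘(ℝ, E) 𝓘(ℝ, E) ∞ (extChartAt 𝓘(ℝ, E) (ψ z)) (ψ z) :=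
    contMDiffAt_extChartAt
  have hκψ : ContDiffAt ℝ ∞ (extChartAt 𝓘(ℝ, E) (ψ z) ∘ ψ) z := (hκ.comp z hψ).contDiffAt
  have related : EndoRelatedAt (extChartAt 𝓘(ℝ, E) (ψ z) ∘ ψ) A (K.inChart (ψ z)) z :=
    (K.endoRelatedAt_extChartAt (mem_extChartAt_source _)).comp h (hκ.of_le (by simp))
      (hψ.of_le (by simp))
  have chain_rule (w : F) : fderiv ℝ (extChartAt 𝓘(ℝ, E) (ψ z) ∘ ψ) z w =
      mfderiv 𝓘(ℝ, E) 𝓘(ℝ, E) (extChartAt 𝓘(ℝ, E) (ψ z)) (ψ z)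
        (mfderiv 𝓘(ℝ, F) 𝓘(ℝ, E) ψ z w) := by
    rw [← mfderiv_eq_fderiv]
    exact mfderiv_comp_apply z (hκ.mdifferentiableAt (by simp)) (hψ.mdifferentiableAt (by simp)) w
  refine (isInvertible_mfderiv_extChartAt (mem_extChartAt_source (ψ z))).injective ?_
  rw [K.mfderiv_nijenhuis, ← chain_rule, ← chain_rule, ← chain_rule]
  refine (nijenhuisTensor_map (contDiffAt_infty.1 hκψ 2) hA ?_ ?_ _ _).symm
  · exact (K.contDiffAt_inChart _).differentiableAt (by simp)
  · simpa only [EndoRelatedAt, mfderiv_eq_fderiv] using! related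

variable {E' : Type*} [NormedAddCommGroup E'] [NormedSpace ℝ E'] [FiniteDimensional ℝ E']
  {N' : Type*} [TopologicalSpace N'] [ChartedSpace E' N'] [IsManifold 𝓘(ℝ, E') ∞ N']

theorem mfderiv_nijenhuis_of_endoRelatedAt (K : VForm E N 1) (K' : VForm E' N' 1) {f : N → N'}
    {x : N} (hf : ContMDiffAt 𝓘(ℝ, E) 𝓘(ℝ, E') ∞ f x) (h : EndoRelatedAt f K.endo K'.endo x)
    (v : Fin 2 → TangentSpace 𝓘(ℝ, E) x) :
    mfderiv 𝓘(ℝ, E) 𝓘(ℝ, E') f x (K.nijenhuis.toFun x v) =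
      K'.nijenhuis.toFun (f x) (fun i ↦ mfderiv 𝓘(ℝ, E) 𝓘(ℝ, E') f x (v i)) := by
  obtain ⟨x₀, hx₀⟩ : ∃ x₀, x₀ = x := ⟨x, rfl⟩
  obtain ⟨y, hy⟩ : ∃ y, y = extChartAt 𝓘(ℝ, E) x₀ x₀ := ⟨_, rfl⟩
  obtain rfl : (extChartAt 𝓘(ℝ, E) x₀).symm y = x := by rw [hy, extChartAt_to_inv, hx₀]
  have hyt : y ∈ (extChartAt 𝓘(ℝ, E) x₀).target := hy ▸ mem_extChartAt_target x₀
  have hχ := (contMDiffOn_extChartAt_symm (I := 𝓘(ℝ, E)) (n := ∞) x₀).contMDiffAt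
    ((isOpen_extChartAt_target x₀).mem_nhds hyt)
  have hA : DifferentiableAt ℝ (K.inChart x₀) y :=
    hy ▸ (K.contDiffAt_inChart x₀).differentiableAt (by simp)
  have relχ := K.endoRelatedAt_extChartAt_symm hyt
  obtain ⟨w, rfl⟩ : ∃ w : Fin 2 → E,
      (fun i ↦ mfderiv 𝓘(ℝ, E) 𝓘(ℝ, E) (extChartAt 𝓘(ℝ, E) x₀).symm y (w i)) = v :=
    ⟨_, funext fun i ↦ mfderiv_symm_mfderiv_extChartAt hyt (v i)⟩
  have chain_rule (a : E) := mfderiv_comp_apply (v := a) y (hf.mdifferentiableAt (by simp))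
    (hχ.mdifferentiableAt (by simp))
  rw [← K.mfderiv_nijenhuisTensor hχ hA relχ, ← chain_rule]
  simp only [← chain_rule]
  exact K'.mfderiv_nijenhuisTensor (hf.comp y hχ) hA
    (h.comp relχ (hf.of_le (by simp)) (hχ.of_le (by simp))) w

end VForm

section LevelSets

variable {V : Type*} [NormedAddCommGroup V] [NormedSpace ℝ V] [FiniteDimensional ℝ V]
  {W : Type*} [NormedAddCommGroup W] [NormedSpace ℝ W] [FiniteDimensional ℝ W]

theorem exists_straightening {f : V → W} {p : V} (hf : ContDiffAt ℝ ∞ f p)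
    (hs : Function.Surjective (fderiv ℝ f p)) :
    ∃ (S : Submodule ℝ V) (ρ : V →L[ℝ] S) (Φ : OpenPartialHomeomorph V (W × S)),
      p ∈ Φ.source ∧ (∀ y, Φ y = (f y, ρ (y - p))) ∧ ContDiffAt ℝ ∞ Φ.symm (f p, 0) := by
  have : CompleteSpace V := FiniteDimensional.complete ℝ V
  have : CompleteSpace W := FiniteDimensional.complete ℝ W
  have ker_complemented : (fderiv ℝ f p).ker.ClosedComplemented :=
    Submodule.ClosedComplemented.of_finiteDimensional _
  let d := HasStrictFDerivAt.implicitFunctionDataOfComplemented f (fderiv ℝ f p)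
    (hf.hasStrictFDerivAt (by simp)) (LinearMap.range_eq_top.2 hs) ker_complemented
  let Φ := d.toOpenPartialHomeomorph
  let ρ := Classical.choose ker_complemented
  have hΦ : ∀ y, Φ y = (f y, ρ (y - p)) := fun y ↦ rfl
  have hp : p ∈ Φ.source := d.pt_mem_toOpenPartialHomeomorph_source
  have hΦp : Φ p = (f p, 0) := by rw [hΦ, sub_self, map_zero]
  refine ⟨_, ρ, Φ, hp, hΦ, ?_⟩
  rw [← hΦp]
  exact Φ.contDiffAt_symm (Φ.map_source hp)
    (by rw [Φ.left_inv hp]; exact d.hasStrictFDerivAt.hasFDerivAt)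
    (by
      rw [Φ.left_inv hp]
      exact hf.prodMk (ρ.contDiff.comp (contDiff_id.sub contDiff_const)).contDiffAt)

theorem exists_levelSet_parametrization {f : V → W} {p : V} (hf : ContDiffAt ℝ ∞ f p)
    (hs : Function.Surjective (fderiv ℝ f p)) :
    ∃ (S : Submodule ℝ V) (ρ : V →L[ℝ] S) (φ : S → V), φ 0 = p ∧ ContDiffAt ℝ ∞ φ 0 ∧
      (∀ᶠ z in 𝓝 0, f (φ z) = f p) ∧
      ∀ᶠ z in 𝓝 0, ∀ w, fderiv ℝ f (φ z) w = 0 → fderiv ℝ φ z (ρ w) = w := by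
  obtain ⟨S, ρ, Φ, hp, hΦ, hΦsymm⟩ := exists_straightening hf hs
  have hΦp : Φ p = (f p, 0) := by rw [hΦ, sub_self, map_zero]
  let ι : S → W × S := fun z ↦ (f p, z)
  have hι : ContDiff ℝ ∞ ι := contDiff_const.prodMk contDiff_id
  let φ : S → V := Φ.symm ∘ ι
  have hφ₀ : φ 0 = p := (congrArg Φ.symm hΦp.symm).trans (Φ.left_inv hp)
  have hφ : ContDiffAt ℝ ∞ φ 0 := hΦsymm.comp 0 hι.contDiffAt
  have ι_mem_target : ∀ᶠ z in 𝓝 0, ι z ∈ Φ.target :=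
    hι.continuous.continuousAt.eventually (Φ.open_target.mem_nhds <| by
      simpa only [ι, ← hΦp] using Φ.map_source hp)
  refine ⟨S, ρ, φ, hφ₀, hφ, ?_, ?_⟩
  · filter_upwards [ι_mem_target] with z hz
    have h := Φ.right_inv hz
    rw [hΦ] at h
    exact congrArg Prod.fst h
  · have f_diff : ∀ᶠ y in 𝓝 p, ContDiffAt ℝ 1 f y := (hf.of_le (by simp)).eventually (by simp)
    have Φsymm_diff : ∀ᶠ q in 𝓝 (ι 0), ContDiffAt ℝ 1 Φ.symm q :=
      (hΦsymm.of_le (by simp)).eventually (by simp)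
    filter_upwards [ι_mem_target, hφ.continuousAt.eventually (hφ₀.symm ▸ f_diff),
      hι.continuous.continuousAt.eventually Φsymm_diff] with z hz hf hΦsymm w hw
    have symm_deriv := (hΦsymm.differentiableAt one_ne_zero).hasFDerivAt
    have symm_deriv' : HasFDerivAt Φ.symm (fderiv ℝ Φ.symm (ι z)) (Φ (φ z)) := by
      rwa [show Φ (φ z) = ι z from Φ.right_inv hz]
    have Φ_deriv : HasFDerivAt Φ ((fderiv ℝ f (φ z)).prod ρ) (φ z) := by
      rw [funext hΦ]
      exact (hf.differentiableAt one_ne_zero).hasFDerivAt.prodMk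
        (ρ.hasFDerivAt.comp _ ((hasFDerivAt_id _).sub_const p))
    have left_inv : Φ.symm ∘ Φ =ᶠ[𝓝 (φ z)] id :=
      Filter.mem_of_superset (Φ.open_source.mem_nhds (Φ.map_target hz)) fun _ ↦ Φ.left_inv
    have symm_deriv_comp_deriv := (symm_deriv'.comp (φ z) Φ_deriv).unique
      ((hasFDerivAt_id _).congr_of_eventuallyEq left_inv)
    rw [show fderiv ℝ φ z = _ from (symm_deriv.comp z (hasFDerivAt_prodMk_right (f p) z)).fderiv]
    simpa [hw] using! DFunLike.congr_fun symm_deriv_comp_deriv w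

theorem exists_levelSet_parametrization_endoRelatedAt {f : V → W} {p : V} {A : V → V →L[ℝ] V}
    (hf : ContDiffAt ℝ ∞ f p) (hs : Function.Surjective (fderiv ℝ f p))
    (hA : DifferentiableAt ℝ A p)
    (h : ∀ᶠ y in 𝓝 p, f y = f p → ∀ w, fderiv ℝ f y w = 0 → fderiv ℝ f y (A y w) = 0) :
    ∃ (S : Submodule ℝ V) (φ : S → V) (B : S → S →L[ℝ] S), φ 0 = p ∧ ContDiffAt ℝ ∞ φ 0 ∧
      DifferentiableAt ℝ B 0 ∧ (∀ᶠ z in 𝓝 0, f (φ z) = f p) ∧ EndoRelatedAt φ B A 0 ∧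
      ∀ w, fderiv ℝ f p w = 0 → ∃ u, fderiv ℝ φ 0 u = w := by
  obtain ⟨S, ρ, φ, rfl, hφ, f_φ, ρ_inv⟩ := exists_levelSet_parametrization hf hs
  refine ⟨S, φ, fun z ↦ ρ.comp ((A (φ z)).comp (fderiv ℝ φ z)), rfl, hφ, ?_, f_φ, ?_,
    fun w hw ↦ ⟨ρ w, ρ_inv.self_of_nhds w hw⟩⟩
  · have fderiv_diff : DifferentiableAt ℝ (fderiv ℝ φ) 0 :=
      (hφ.fderiv_right (m := 1) (by norm_cast)).differentiableAt one_ne_zero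
    exact (differentiableAt_const ρ).clm_comp
      ((hA.comp 0 (hφ.differentiableAt (by simp))).clm_comp fderiv_diff)
  · have f_diff : ∀ᶠ y in 𝓝 (φ 0), ContDiffAt ℝ 1 f y :=
      (hf.of_le (by simp)).eventually (by simp)
    have φ_diff : ∀ᶠ z in 𝓝 0, ContDiffAt ℝ 1 φ z := (hφ.of_le (by simp)).eventually (by simp)
    filter_upwards [ρ_inv, f_φ.eventually_nhds, hφ.continuousAt.eventually f_diff, φ_diff,
      hφ.continuousAt.eventually h] with z ρ_inv f_φ f_diff φ_diff h u
    have fderiv_φ_mem_ker : fderiv ℝ f (φ z) (fderiv ℝ φ z u) = 0 := by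
      have comp_deriv := (f_diff.differentiableAt one_ne_zero).hasFDerivAt.comp z
        (φ_diff.differentiableAt one_ne_zero).hasFDerivAt
      have const_deriv := (hasFDerivAt_const (𝕜 := ℝ) (f (φ 0)) z).congr_of_eventuallyEq f_φ
      exact DFunLike.congr_fun (comp_deriv.unique const_deriv) u
    rw [mfderiv_eq_fderiv]
    exact ρ_inv _ (h f_φ.self_of_nhds _ fderiv_φ_mem_ker)

end LevelSets

theorem tangentBundle_mk_eq_mk_iff {E : Type*} [NormedAddCommGroup E] [NormedSpace ℝ E]
    {N : Type*} [TopologicalSpace N] [ChartedSpace E N] {x y : N}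
    {v : TangentSpace 𝓘(ℝ, E) x} {w : TangentSpace 𝓘(ℝ, E) y} :
    (⟨x, v⟩ : TangentBundle 𝓘(ℝ, E) N) = ⟨y, w⟩ ↔ x = y ∧ @Eq E v w := by
  refine ⟨fun h ↦ ?_, ?_⟩
  · exact ⟨congrArg TotalSpace.proj h,
      congrArg (fun p : TangentBundle 𝓘(ℝ, E) N ↦ (show E from p.2)) h⟩
  · rintro ⟨rfl, h⟩
    exact congrArg (TotalSpace.mk' E x) h

section FibreProducts

variable {E₁ : Type*} [NormedAddCommGroup E₁] [NormedSpace ℝ E₁]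
  {N₁ : Type*} [TopologicalSpace N₁] [ChartedSpace E₁ N₁]
  {E₂ : Type*} [NormedAddCommGroup E₂] [NormedSpace ℝ E₂]
  {N₂ : Type*} [TopologicalSpace N₂] [ChartedSpace E₂ N₂]
  {E' : Type*} [NormedAddCommGroup E'] [NormedSpace ℝ E']
  {M : Type*} [TopologicalSpace M] [ChartedSpace E' M]
  {S : Type*} [NormedAddCommGroup S] [NormedSpace ℝ S]

/-- A pair of maps `φ₁`, `φ₂` from a vector space parametrizes the fibre product of `f₁ : N₁ → M`
and `f₂ : N₂ → M` near `(x₁, x₂)`, and a field `A` of endomorphisms of that vector space represents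
the fields `K₁` and `K₂` on the factors. Of a parametrization, only what is needed to compute with
tangent vectors is recorded: every tangent vector at `(x₁, x₂)` is the velocity of the pair. -/
structure IsFibreProductParametrization (f₁ : N₁ → M) (f₂ : N₂ → M)
    (K₁ : ∀ x : N₁, TangentSpace 𝓘(ℝ, E₁) x →L[ℝ] TangentSpace 𝓘(ℝ, E₁) x)
    (K₂ : ∀ x : N₂, TangentSpace 𝓘(ℝ, E₂) x →L[ℝ] TangentSpace 𝓘(ℝ, E₂) x) (x₁ : N₁) (x₂ : N₂)
    (φ₁ : S → N₁) (φ₂ : S → N₂) (A : S → S →L[ℝ] S) : Prop where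
  map_zero₁ : φ₁ 0 = x₁
  map_zero₂ : φ₂ 0 = x₂
  contMDiffAt₁ : ContMDiffAt 𝓘(ℝ, S) 𝓘(ℝ, E₁) ∞ φ₁ 0
  contMDiffAt₂ : ContMDiffAt 𝓘(ℝ, S) 𝓘(ℝ, E₂) ∞ φ₂ 0
  differentiableAt : DifferentiableAt ℝ A 0
  eventually_eq : ∀ᶠ z in 𝓝 0, f₁ (φ₁ z) = f₂ (φ₂ z)
  endoRelatedAt₁ : EndoRelatedAt φ₁ A K₁ 0
  endoRelatedAt₂ : EndoRelatedAt φ₂ A K₂ 0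
  exists_tangentMap_eq (X : TangentSpace 𝓘(ℝ, E₁) x₁) (Y : TangentSpace 𝓘(ℝ, E₂) x₂) :
    tangentMap 𝓘(ℝ, E₁) 𝓘(ℝ, E') f₁ ⟨x₁, X⟩ = tangentMap 𝓘(ℝ, E₂) 𝓘(ℝ, E') f₂ ⟨x₂, Y⟩ →
      ∃ u : TangentSpace 𝓘(ℝ, S) (0 : S), tangentMap 𝓘(ℝ, S) 𝓘(ℝ, E₁) φ₁ ⟨0, u⟩ = ⟨x₁, X⟩ ∧
        tangentMap 𝓘(ℝ, S) 𝓘(ℝ, E₂) φ₂ ⟨0, u⟩ = ⟨x₂, Y⟩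

end FibreProducts

section FibreProductsInVectorSpace

variable {F₁ : Type*} [NormedAddCommGroup F₁] [NormedSpace ℝ F₁]
  {F₂ : Type*} [NormedAddCommGroup F₂] [NormedSpace ℝ F₂]
  {W : Type*} [NormedAddCommGroup W] [NormedSpace ℝ W]

theorem fderiv_fst_sub_snd {g₁ : F₁ → W} {g₂ : F₂ → W} {y : F₁ × F₂}
    (hg₁ : DifferentiableAt ℝ g₁ y.1) (hg₂ : DifferentiableAt ℝ g₂ y.2) (w : F₁ × F₂) :
    fderiv ℝ (fun y : F₁ × F₂ ↦ g₁ y.1 - g₂ y.2) y w =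
      fderiv ℝ g₁ y.1 w.1 - fderiv ℝ g₂ y.2 w.2 :=
  DFunLike.congr_fun ((hg₁.hasFDerivAt.comp y hasFDerivAt_fst).sub
    (hg₂.hasFDerivAt.comp y hasFDerivAt_snd)).fderiv w

theorem endoRelatedAt_fst (A₁ : F₁ → F₁ →L[ℝ] F₁) (A₂ : F₂ → F₂ →L[ℝ] F₂) (p : F₁ × F₂) :
    EndoRelatedAt (E := F₁ × F₂) Prod.fst (fun y : F₁ × F₂ ↦ (A₁ y.1).prodMap (A₂ y.2)) A₁ p :=
  .of_forall fun y v ↦ by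
    rw [mfderiv_eq_fderiv, fderiv_fst]
    rfl

theorem endoRelatedAt_snd (A₁ : F₁ → F₁ →L[ℝ] F₁) (A₂ : F₂ → F₂ →L[ℝ] F₂) (p : F₁ × F₂) :
    EndoRelatedAt (E := F₁ × F₂) Prod.snd (fun y : F₁ × F₂ ↦ (A₁ y.1).prodMap (A₂ y.2)) A₂ p :=
  .of_forall fun y v ↦ by
    rw [mfderiv_eq_fderiv, fderiv_snd]
    rfl

theorem isFibreProductParametrization_fst_snd {S : Type*} [NormedAddCommGroup S] [NormedSpace ℝ S]
    {g₁ : F₁ → W} {g₂ : F₂ → W} {A₁ : F₁ → F₁ →L[ℝ] F₁} {A₂ : F₂ → F₂ →L[ℝ] F₂} {p : F₁ × F₂}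
    {φ : S → F₁ × F₂} {C : S → S →L[ℝ] S} (hφ₀ : φ 0 = p) (hφ : ContDiffAt ℝ ∞ φ 0)
    (hC : DifferentiableAt ℝ C 0) (eventually_eq : ∀ᶠ z in 𝓝 0, g₁ (φ z).1 = g₂ (φ z).2)
    (related : EndoRelatedAt φ C (fun y : F₁ × F₂ ↦ (A₁ y.1).prodMap (A₂ y.2)) 0)
    (exists_fderiv_eq : ∀ w : F₁ × F₂,
      fderiv ℝ g₁ p.1 w.1 = fderiv ℝ g₂ p.2 w.2 → ∃ u, fderiv ℝ φ 0 u = w) :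
    IsFibreProductParametrization (M := W) (E' := W) g₁ g₂ A₁ A₂ p.1 p.2
      (Prod.fst ∘ φ) (Prod.snd ∘ φ) C := by
  have hφ' := hφ.contMDiffAt.of_le (m := 1) (by simp)
  have hφd := hφ.differentiableAt (by simp)
  refine ⟨congrArg Prod.fst hφ₀, congrArg Prod.snd hφ₀,
    hφ.fst.contMDiffAt, hφ.snd.contMDiffAt, hC, eventually_eq,
    (endoRelatedAt_fst A₁ A₂ _).comp related contDiffAt_fst.contMDiffAt hφ',
    (endoRelatedAt_snd A₁ A₂ _).comp related contDiffAt_snd.contMDiffAt hφ', fun X Y hXY ↦ ?_⟩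
  obtain ⟨-, hXY⟩ := tangentBundle_mk_eq_mk_iff.1 hXY
  obtain ⟨u, hu⟩ := exists_fderiv_eq (X, Y) <| by simpa only [mfderiv_eq_fderiv] using! hXY
  refine ⟨u, tangentBundle_mk_eq_mk_iff.2 ⟨congrArg Prod.fst hφ₀, ?_⟩,
    tangentBundle_mk_eq_mk_iff.2 ⟨congrArg Prod.snd hφ₀, ?_⟩⟩
  · rw [mfderiv_eq_fderiv]
    exact (DFunLike.congr_fun (fderiv.fst hφd) u).trans (congrArg Prod.fst hu)
  · rw [mfderiv_eq_fderiv]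
    exact (DFunLike.congr_fun (fderiv.snd hφd) u).trans (congrArg Prod.snd hu)

variable [FiniteDimensional ℝ F₁] [FiniteDimensional ℝ F₂] [FiniteDimensional ℝ W]

theorem exists_isFibreProductParametrization_vectorSpace {g₁ : F₁ → W} {g₂ : F₂ → W}
    {A₁ : F₁ → F₁ →L[ℝ] F₁} {A₂ : F₂ → F₂ →L[ℝ] F₂} {B : W → W →L[ℝ] W} {p₁ : F₁} {p₂ : F₂}
    (hp : g₁ p₁ = g₂ p₂) (hg₁ : ContDiffAt ℝ ∞ g₁ p₁) (hg₂ : ContDiffAt ℝ ∞ g₂ p₂)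
    (hs : Function.Surjective (fderiv ℝ g₁ p₁))
    (hA₁ : DifferentiableAt ℝ A₁ p₁) (hA₂ : DifferentiableAt ℝ A₂ p₂)
    (h₁ : EndoRelatedAt g₁ A₁ B p₁) (h₂ : EndoRelatedAt g₂ A₂ B p₂) :
    ∃ (S : Submodule ℝ (F₁ × F₂)) (φ₁ : S → F₁) (φ₂ : S → F₂) (C : S → S →L[ℝ] S),
      IsFibreProductParametrization (M := W) (E' := W) g₁ g₂ A₁ A₂ p₁ p₂ φ₁ φ₂ C := by
  let f : F₁ × F₂ → W := fun y ↦ g₁ y.1 - g₂ y.2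
  let A : F₁ × F₂ → (F₁ × F₂) →L[ℝ] (F₁ × F₂) := fun y ↦ (A₁ y.1).prodMap (A₂ y.2)
  have f_eq_iff (y : F₁ × F₂) : f y = f (p₁, p₂) ↔ g₁ y.1 = g₂ y.2 := by
    simp only [f, hp, sub_self, sub_eq_zero]
  have hf : ContDiffAt ℝ ∞ f (p₁, p₂) := hg₁.fst''.sub hg₂.snd''
  have hA : DifferentiableAt ℝ A (p₁, p₂) :=
    (ContinuousLinearMap.prodMapL ℝ F₁ F₁ F₂ F₂).differentiableAt.comp _
      ((hA₁.comp (p₁, p₂) differentiableAt_fst).prodMk (hA₂.comp (p₁, p₂) differentiableAt_snd))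
  have fderiv_f : ∀ᶠ y in 𝓝 (p₁, p₂), ∀ w : F₁ × F₂,
      fderiv ℝ f y w = fderiv ℝ g₁ y.1 w.1 - fderiv ℝ g₂ y.2 w.2 := by
    have hg₁' : ∀ᶠ y in 𝓝 p₁, ContDiffAt ℝ 1 g₁ y := (hg₁.of_le (by simp)).eventually (by simp)
    have hg₂' : ∀ᶠ y in 𝓝 p₂, ContDiffAt ℝ 1 g₂ y := (hg₂.of_le (by simp)).eventually (by simp)
    filter_upwards [continuousAt_fst.eventually hg₁', continuousAt_snd.eventually hg₂']
      with y hg₁ hg₂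
    exact fderiv_fst_sub_snd (hg₁.differentiableAt one_ne_zero) (hg₂.differentiableAt one_ne_zero)
  have A_ker : ∀ᶠ y in 𝓝 (p₁, p₂), f y = f (p₁, p₂) → ∀ w, fderiv ℝ f y w = 0 →
      fderiv ℝ f y (A y w) = 0 := by
    filter_upwards [fderiv_f, continuousAt_fst.eventually h₁, continuousAt_snd.eventually h₂]
      with y fderiv_f h₁ h₂ hy w hw
    simp only [mfderiv_eq_fderiv] at h₁ h₂
    rw [fderiv_f, sub_eq_zero] at hw ⊢
    refine (h₁ w.1).trans (Eq.trans ?_ (h₂ w.2).symm)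
    exact congrArg₂ (fun (y w : W) ↦ B y w) ((f_eq_iff y).1 hy) hw
  have f_surjective : Function.Surjective (fderiv ℝ f (p₁, p₂)) := fun w ↦ by
    obtain ⟨v, rfl⟩ := hs w
    exact ⟨(v, 0), by simp [fderiv_f.self_of_nhds]⟩
  obtain ⟨S, φ, C, hφ₀, hφ, hC, f_φ, related, ker_subset⟩ :=
    exists_levelSet_parametrization_endoRelatedAt hf f_surjective hA A_ker
  refine ⟨S, Prod.fst ∘ φ, Prod.snd ∘ φ, C, isFibreProductParametrization_fst_snd hφ₀ hφ hC
    (f_φ.mono fun z ↦ (f_eq_iff _).1) related fun w hw ↦ ker_subset w ?_⟩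
  rw [fderiv_f.self_of_nhds, hw, sub_self]

end FibreProductsInVectorSpace

theorem eventuallyEq_of_extChartAt_eq {𝕜 : Type*} [NontriviallyNormedField 𝕜]
    {E : Type*} [NormedAddCommGroup E] [NormedSpace 𝕜 E] {H : Type*} [TopologicalSpace H]
    {I : ModelWithCorners 𝕜 E H} {M : Type*} [TopologicalSpace M] [ChartedSpace H M]
    {Z : Type*} [TopologicalSpace Z] {f₁ f₂ : Z → M} {z₀ : Z} {y : M}
    (hf₁ : ContinuousAt f₁ z₀) (hf₂ : ContinuousAt f₂ z₀) (h₁ : f₁ z₀ = y) (h₂ : f₂ z₀ = y)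
    (h : ∀ᶠ z in 𝓝 z₀, extChartAt I y (f₁ z) = extChartAt I y (f₂ z)) : f₁ =ᶠ[𝓝 z₀] f₂ := by
  have hy := extChartAt_source_mem_nhds (I := I) y
  rw [ContinuousAt, h₁] at hf₁
  rw [ContinuousAt, h₂] at hf₂
  filter_upwards [h, hf₁ hy, hf₂ hy] with z hz hz₁ hz₂
  exact (extChartAt I y).injOn hz₁ hz₂ hz

section ChartExpressions

variable {E : Type*} [NormedAddCommGroup E] [NormedSpace ℝ E]
  {N : Type*} [TopologicalSpace N] [ChartedSpace E N]
  {E' : Type*} [NormedAddCommGroup E'] [NormedSpace ℝ E']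
  {M : Type*} [TopologicalSpace M] [ChartedSpace E' M]

theorem contDiffAt_writtenInExtChartAt {f : N → M} {x : N} {n : ℕ∞ω}
    (hf : ContMDiffAt 𝓘(ℝ, E) 𝓘(ℝ, E') n f x) :
    ContDiffAt ℝ n (writtenInExtChartAt 𝓘(ℝ, E) 𝓘(ℝ, E') x f) (extChartAt 𝓘(ℝ, E) x x) := by
  have h := (contMDiffAt_iff.1 hf).2
  rwa [𝓘(ℝ, E).range_eq_univ, contDiffWithinAt_univ] at h

theorem mfderiv_eq_fderiv_writtenInExtChartAt {f : N → M} {x : N}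
    (hf : MDifferentiableAt 𝓘(ℝ, E) 𝓘(ℝ, E') f x) :
    mfderiv 𝓘(ℝ, E) 𝓘(ℝ, E') f x =
      fderiv ℝ (writtenInExtChartAt 𝓘(ℝ, E) 𝓘(ℝ, E') x f) (extChartAt 𝓘(ℝ, E) x x) := by
  rw [hf.mfderiv, 𝓘(ℝ, E).range_eq_univ, fderivWithin_univ]

theorem tangentMap_writtenInExtChartAt {f : N → M} {x : N}
    (hf : MDifferentiableAt 𝓘(ℝ, E) 𝓘(ℝ, E') f x) (v : TangentSpace 𝓘(ℝ, E) x) :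
    tangentMap 𝓘(ℝ, E) 𝓘(ℝ, E') (writtenInExtChartAt 𝓘(ℝ, E) 𝓘(ℝ, E') x f)
      ⟨extChartAt 𝓘(ℝ, E) x x, v⟩ =
        ⟨extChartAt 𝓘(ℝ, E') (f x) (f x), mfderiv 𝓘(ℝ, E) 𝓘(ℝ, E') f x v⟩ := by
  refine tangentBundle_mk_eq_mk_iff.2 ⟨?_, ?_⟩
  · simp only [writtenInExtChartAt, Function.comp_apply, extChartAt_to_inv]
  · rw [mfderiv_eq_fderiv, mfderiv_eq_fderiv_writtenInExtChartAt hf]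
    rfl

theorem contMDiffAt_extChartAt_symm_self [IsManifold 𝓘(ℝ, E) ∞ N] (x : N) :
    ContMDiffAt 𝓘(ℝ, E) 𝓘(ℝ, E) ∞ (extChartAt 𝓘(ℝ, E) x).symm (extChartAt 𝓘(ℝ, E) x x) :=
  (contMDiffOn_extChartAt_symm x).contMDiffAt (extChartAt_target_mem_nhds x)

theorem tangentMap_extChartAt_symm_self [IsManifold 𝓘(ℝ, E) ∞ N] (x : N)
    (v : TangentSpace 𝓘(ℝ, E) x) :
    tangentMap 𝓘(ℝ, E) 𝓘(ℝ, E) (extChartAt 𝓘(ℝ, E) x).symm ⟨extChartAt 𝓘(ℝ, E) x x, v⟩ =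
      ⟨x, v⟩ := by
  refine tangentBundle_mk_eq_mk_iff.2 ⟨extChartAt_to_inv x, ?_⟩
  have h : writtenInExtChartAt 𝓘(ℝ, E) 𝓘(ℝ, E) (extChartAt 𝓘(ℝ, E) x x)
      (extChartAt 𝓘(ℝ, E) x).symm =ᶠ[𝓝 (extChartAt 𝓘(ℝ, E) x x)] id := by
    filter_upwards [extChartAt_target_mem_nhds (I := 𝓘(ℝ, E)) x] with y hy
    simp only [writtenInExtChartAt, extChartAt_to_inv]
    exact (extChartAt 𝓘(ℝ, E) x).right_inv hy
  rw [mfderiv_eq_fderiv_writtenInExtChartAt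
    ((contMDiffAt_extChartAt_symm_self x).mdifferentiableAt (by simp))]
  exact DFunLike.congr_fun (h.fderiv_eq.trans fderiv_id) v

end ChartExpressions

section FibreProductsInManifolds

variable {E₁ : Type*} [NormedAddCommGroup E₁] [NormedSpace ℝ E₁]
  {N₁ : Type*} [TopologicalSpace N₁] [ChartedSpace E₁ N₁] [IsManifold 𝓘(ℝ, E₁) ∞ N₁]
  {E₂ : Type*} [NormedAddCommGroup E₂] [NormedSpace ℝ E₂]
  {N₂ : Type*} [TopologicalSpace N₂] [ChartedSpace E₂ N₂] [IsManifold 𝓘(ℝ, E₂) ∞ N₂]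
  {E' : Type*} [NormedAddCommGroup E'] [NormedSpace ℝ E']
  {M : Type*} [TopologicalSpace M] [ChartedSpace E' M]

theorem IsFibreProductParametrization.extChartAt_symm_comp {S : Type*} [NormedAddCommGroup S]
    [NormedSpace ℝ S] {K₁ : VForm E₁ N₁ 1} {K₂ : VForm E₂ N₂ 1} {f₁ : N₁ → M} {f₂ : N₂ → M}
    {x₁ : N₁} {x₂ : N₂} {φ₁ : S → E₁} {φ₂ : S → E₂} {A : S → S →L[ℝ] S} (hx : f₁ x₁ = f₂ x₂)
    (hf₁ : MDifferentiableAt 𝓘(ℝ, E₁) 𝓘(ℝ, E') f₁ x₁)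
    (hf₂ : MDifferentiableAt 𝓘(ℝ, E₂) 𝓘(ℝ, E') f₂ x₂)
    (h : IsFibreProductParametrization (M := E') (E' := E')
      (writtenInExtChartAt 𝓘(ℝ, E₁) 𝓘(ℝ, E') x₁ f₁) (writtenInExtChartAt 𝓘(ℝ, E₂) 𝓘(ℝ, E') x₂ f₂)
      (K₁.inChart x₁) (K₂.inChart x₂) (extChartAt 𝓘(ℝ, E₁) x₁ x₁) (extChartAt 𝓘(ℝ, E₂) x₂ x₂)
      φ₁ φ₂ A) :
    IsFibreProductParametrization (E' := E') f₁ f₂ K₁.endo K₂.endo x₁ x₂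
      ((extChartAt 𝓘(ℝ, E₁) x₁).symm ∘ φ₁) ((extChartAt 𝓘(ℝ, E₂) x₂).symm ∘ φ₂) A := by
  have hχ₁ : ContMDiffAt 𝓘(ℝ, E₁) 𝓘(ℝ, E₁) ∞ (extChartAt 𝓘(ℝ, E₁) x₁).symm (φ₁ 0) :=
    h.map_zero₁ ▸ contMDiffAt_extChartAt_symm_self x₁
  have hχ₂ : ContMDiffAt 𝓘(ℝ, E₂) 𝓘(ℝ, E₂) ∞ (extChartAt 𝓘(ℝ, E₂) x₂).symm (φ₂ 0) :=
    h.map_zero₂ ▸ contMDiffAt_extChartAt_symm_self x₂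
  have hx₁ : ((extChartAt 𝓘(ℝ, E₁) x₁).symm ∘ φ₁) 0 = x₁ :=
    (congrArg _ h.map_zero₁).trans (extChartAt_to_inv x₁)
  have hx₂ : ((extChartAt 𝓘(ℝ, E₂) x₂).symm ∘ φ₂) 0 = x₂ :=
    (congrArg _ h.map_zero₂).trans (extChartAt_to_inv x₂)
  have hχφ₁ := hχ₁.comp 0 h.contMDiffAt₁
  have hχφ₂ := hχ₂.comp 0 h.contMDiffAt₂
  refine ⟨hx₁, hx₂, hχφ₁, hχφ₂, h.differentiableAt, ?_,
    .comp (K₁.endoRelatedAt_extChartAt_symm (h.map_zero₁ ▸ mem_extChartAt_target x₁))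
      h.endoRelatedAt₁ (hχ₁.of_le (by simp)) (h.contMDiffAt₁.of_le (by simp)),
    .comp (K₂.endoRelatedAt_extChartAt_symm (h.map_zero₂ ▸ mem_extChartAt_target x₂))
      h.endoRelatedAt₂ (hχ₂.of_le (by simp)) (h.contMDiffAt₂.of_le (by simp)), fun X Y hXY ↦ ?_⟩
  · refine eventuallyEq_of_extChartAt_eq (I := 𝓘(ℝ, E'))
      (hf₁.continuousAt.comp_of_eq hχφ₁.continuousAt hx₁)
      (hf₂.continuousAt.comp_of_eq hχφ₂.continuousAt hx₂)
      (congrArg f₁ hx₁) ((congrArg f₂ hx₂).trans hx.symm) ?_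
    simpa only [writtenInExtChartAt, ← hx, Function.comp_apply] using h.eventually_eq
  · obtain ⟨-, hXY'⟩ := tangentBundle_mk_eq_mk_iff.1 hXY
    obtain ⟨u, hu₁, hu₂⟩ := h.exists_tangentMap_eq X Y <| by
      rw [tangentMap_writtenInExtChartAt hf₁, tangentMap_writtenInExtChartAt hf₂]
      exact tangentBundle_mk_eq_mk_iff.2 ⟨by rw [hx], hXY'⟩
    refine ⟨u, ?_, ?_⟩
    · rw [tangentMap_comp_at _ (hχ₁.mdifferentiableAt (by simp))
        (h.contMDiffAt₁.mdifferentiableAt (by simp)), hu₁, tangentMap_extChartAt_symm_self]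
    · rw [tangentMap_comp_at _ (hχ₂.mdifferentiableAt (by simp))
        (h.contMDiffAt₂.mdifferentiableAt (by simp)), hu₂, tangentMap_extChartAt_symm_self]

variable [IsManifold 𝓘(ℝ, E') ∞ M]

theorem VForm.endoRelatedAt_writtenInExtChartAt {K : VForm E₁ N₁ 1} {K_M : VForm E' M 1}
    {f : N₁ → M} {x : N₁} (hf : ContMDiffAt 𝓘(ℝ, E₁) 𝓘(ℝ, E') 1 f x)
    (h : EndoRelatedAt f K.endo K_M.endo x) :
    EndoRelatedAt (writtenInExtChartAt 𝓘(ℝ, E₁) 𝓘(ℝ, E') x f) (K.inChart x) (K_M.inChart (f x))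
      (extChartAt 𝓘(ℝ, E₁) x x) := by
  have hχ := (contMDiffAt_extChartAt_symm_self (E := E₁) x).of_le (m := 1) (by simp)
  have hκ := contMDiffAt_extChartAt (I := 𝓘(ℝ, E')) (n := 1) (x := f x)
  have hfχ : EndoRelatedAt (f ∘ (extChartAt 𝓘(ℝ, E₁) x).symm) (K.inChart x) K_M.endo
      (extChartAt 𝓘(ℝ, E₁) x x) := by
    refine .comp ?_ (K.endoRelatedAt_extChartAt_symm (mem_extChartAt_target x)) ?_ hχ <;>
      rwa [extChartAt_to_inv]
  refine .comp ?_ hfχ ?_ ?_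
  · rw [Function.comp_apply, extChartAt_to_inv]
    exact K_M.endoRelatedAt_extChartAt (mem_extChartAt_source _)
  · rwa [Function.comp_apply, extChartAt_to_inv]
  · exact hf.comp_of_eq hχ (extChartAt_to_inv x)

variable [FiniteDimensional ℝ E₁] [FiniteDimensional ℝ E₂] [FiniteDimensional ℝ E']

theorem exists_isFibreProductParametrization {K₁ : VForm E₁ N₁ 1} {K₂ : VForm E₂ N₂ 1}
    {K_M : VForm E' M 1} {f₁ : N₁ → M} {f₂ : N₂ → M} {x₁ : N₁} {x₂ : N₂} (hx : f₁ x₁ = f₂ x₂)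
    (hf₁ : ContMDiffAt 𝓘(ℝ, E₁) 𝓘(ℝ, E') ∞ f₁ x₁) (hf₂ : ContMDiffAt 𝓘(ℝ, E₂) 𝓘(ℝ, E') ∞ f₂ x₂)
    (hs : Function.Surjective (mfderiv 𝓘(ℝ, E₁) 𝓘(ℝ, E') f₁ x₁))
    (h₁ : EndoRelatedAt f₁ K₁.endo K_M.endo x₁) (h₂ : EndoRelatedAt f₂ K₂.endo K_M.endo x₂) :
    ∃ (S : Submodule ℝ (E₁ × E₂)) (φ₁ : S → N₁) (φ₂ : S → N₂) (A : S → S →L[ℝ] S),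
      IsFibreProductParametrization (E' := E') f₁ f₂ K₁.endo K₂.endo x₁ x₂ φ₁ φ₂ A := by
  have hf₁' := hf₁.mdifferentiableAt (by simp)
  have h₁' := VForm.endoRelatedAt_writtenInExtChartAt (hf₁.of_le (by simp)) h₁
  have h₂' := VForm.endoRelatedAt_writtenInExtChartAt (hf₂.of_le (by simp)) h₂
  rw [← hx] at h₂'
  rw [mfderiv_eq_fderiv_writtenInExtChartAt hf₁'] at hs
  obtain ⟨S, φ₁, φ₂, A, h⟩ := exists_isFibreProductParametrization_vectorSpace
    (by simp only [writtenInExtChartAt, Function.comp_apply, extChartAt_to_inv, hx])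
    (contDiffAt_writtenInExtChartAt hf₁) (contDiffAt_writtenInExtChartAt hf₂) hs
    ((K₁.contDiffAt_inChart x₁).differentiableAt (by simp))
    ((K₂.contDiffAt_inChart x₂).differentiableAt (by simp)) h₁' h₂'
  exact ⟨S, _, _, A, h.extChartAt_symm_comp hx hf₁' (hf₂.mdifferentiableAt (by simp))⟩

end FibreProductsInManifolds

section Submersions

variable {E : Type*} [NormedAddCommGroup E] [NormedSpace ℝ E]
  {N : Type*} [TopologicalSpace N] [ChartedSpace E N]
  {E' : Type*} [NormedAddCommGroup E'] [NormedSpace ℝ E']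
  {M : Type*} [TopologicalSpace M] [ChartedSpace E' M]

theorem mdifferentiable_of_mem_maximalAtlas {n : ℕ∞ω} (hn : n ≠ 0) {e : OpenPartialHomeomorph N E}
    (he : e ∈ IsManifold.maximalAtlas 𝓘(ℝ, E) n N) : e.MDifferentiable 𝓘(ℝ, E) 𝓘(ℝ, E) :=
  ⟨(contMDiffOn_of_mem_maximalAtlas he).mdifferentiableOn hn,
    (contMDiffOn_symm_of_mem_maximalAtlas he).mdifferentiableOn hn⟩

theorem mfderiv_surjective_of_isSubmersionAt {n : ℕ∞ω} (hn : n ≠ 0) {f : N → M} {x : N}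
    (hf : IsSubmersionAt 𝓘(ℝ, E) 𝓘(ℝ, E') n f x) :
    Function.Surjective (mfderiv 𝓘(ℝ, E) 𝓘(ℝ, E') f x) := by
  have hdom := mdifferentiable_of_mem_maximalAtlas hn hf.domChart_mem_maximalAtlas
  have hcod := mdifferentiable_of_mem_maximalAtlas hn hf.codChart_mem_maximalAtlas
  have hx := hf.mem_domChart_source
  have hfx := hf.mem_codChart_source
  let L : E →L[ℝ] E' := (ContinuousLinearMap.fst ℝ E' hf.complement).comp
    (hf.equiv : E →L[ℝ] E' × hf.complement)
  have hL : Function.Surjective L := Prod.fst_surjective.comp hf.equiv.surjective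
  have eventually_eq : hf.codChart ∘ f =ᶠ[𝓝 x] L ∘ hf.domChart := by
    filter_upwards [hf.domChart.open_source.mem_nhds hx] with y hy
    have hy' : hf.domChart y ∈ (hf.domChart.extend 𝓘(ℝ, E)).target := by
      simpa using hf.domChart.map_source hy
    simpa [L, hf.domChart.left_inv hy] using hf.writtenInCharts hy'
  have hcod_f := (hcod.mdifferentiableAt hfx).hasMFDerivAt.comp x
    (hf.contMDiffAt.mdifferentiableAt hn).hasMFDerivAt
  have hL_dom := (L.hasFDerivAt (x := hf.domChart x)).hasMFDerivAt.comp x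
    (hdom.mdifferentiableAt hx).hasMFDerivAt
  have mfderiv_eq := hasMFDerivAt_unique (hL_dom.congr_of_eventuallyEq eventually_eq) hcod_f
  intro w
  obtain ⟨v, hv⟩ := hL (mfderiv 𝓘(ℝ, E') 𝓘(ℝ, E') hf.codChart (f x) w)
  obtain ⟨u, rfl⟩ := hdom.mfderiv_surjective hx v
  exact ⟨u, hcod.mfderiv_injective hfx
    ((DFunLike.congr_fun mfderiv_eq u).symm.trans hv)⟩

end Submersions

section

variable {E : Type*} [NormedAddCommGroup E] [NormedSpace ℝ E]
  {N : Type*} [TopologicalSpace N] [ChartedSpace E N] [IsManifold 𝓘(ℝ, E) ∞ N]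
  {E' : Type*} [NormedAddCommGroup E'] [NormedSpace ℝ E']
  {M : Type*} [TopologicalSpace M] [ChartedSpace E' M] [IsManifold 𝓘(ℝ, E') ∞ M]

theorem VForm.IsProjection.of_surjective {K : VForm E N 1} {K_M : VForm E' M 1} {f : N → M}
    (hK : K.IsProjection) (hf : Function.Surjective f)
    (hf' : ∀ x, Function.Surjective (mfderiv 𝓘(ℝ, E) 𝓘(ℝ, E') f x))
    (h : ∀ x v, mfderiv 𝓘(ℝ, E) 𝓘(ℝ, E') f x (K.endo x v) =
      K_M.endo (f x) (mfderiv 𝓘(ℝ, E) 𝓘(ℝ, E') f x v)) : K_M.IsProjection := by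
  intro y
  obtain ⟨x, rfl⟩ := hf y
  ext w
  obtain ⟨v, rfl⟩ := hf' x w
  rw [ContinuousLinearMap.comp_apply, ← h, ← h]
  exact congrArg _ (DFunLike.congr_fun (hK x) v)

/-- A vector-valued `1`-form, seen as a map `TN → TN`. This is `VForm.toMap` after the
identification of `⊕¹ TN` with `TN`. -/
noncomputable def VForm.endoMap (K : VForm E N 1) (v : TangentBundle 𝓘(ℝ, E) N) :
    TangentBundle 𝓘(ℝ, E) N :=
  ⟨v.proj, K.endo v.proj v.2⟩

end

namespace VForm

variable {E : Type*} [NormedAddCommGroup E] [NormedSpace ℝ E] [FiniteDimensional ℝ E]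
  {N : Type*} [TopologicalSpace N] [ChartedSpace E N] [IsManifold 𝓘(ℝ, E) ∞ N]

theorem curvature_eq_endo_nijenhuis (K : VForm E N 1) (hK : K.IsProjection) (x : N)
    (v : Fin 2 → TangentSpace 𝓘(ℝ, E) x) :
    (K.curvature hK).toFun x v = K.endo x (K.nijenhuis.toFun x v) := by
  have extend (w : TangentSpace 𝓘(ℝ, E) x) :
      ∃ X : ∀ y : N, TangentSpace 𝓘(ℝ, E) y, MDiffAt (T% X) x ∧ X x = w :=
    let ⟨c, hc⟩ := exists_chartField_const_eq w
    ⟨_, mdifferentiableAt_chartField x (differentiableAt_const c), hc⟩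
  obtain ⟨X, hX, hXv⟩ := extend (v 0)
  obtain ⟨Y, hY, hYv⟩ := extend (v 1)
  obtain rfl : ![X x, Y x] = v := by ext i; fin_cases i <;> simp [hXv, hYv]
  have hKX := K.mdifferentiableAt_app hX
  have hKY := K.mdifferentiableAt_app hY
  have hPX := mdifferentiableAt_sub_section hX hKX
  have hPY := mdifferentiableAt_sub_section hY hKY
  have endo_endo (w) : K.endo x (K.endo x w) = K.endo x w := DFunLike.congr_fun (hK x) w
  -- As `K ∘ K = K`, applying `K` to `N_K(X, Y)` gives `K([X, Y] - [KX, Y] - [X, KY] + [KX, KY])`,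
  -- which is the expansion of `K[X - KX, Y - KY]`.
  have hXY := congrArg (K.endo x) (mlieBracket_add_left (W := Y) hPX hKX)
  have hXKY := congrArg (K.endo x) (mlieBracket_add_left (W := K.app Y) hPX hKX)
  have hPXY := congrArg (K.endo x) (mlieBracket_add_right (V := X - K.app X) hPY hKY)
  rw [sub_add_cancel, map_add] at hXY hXKY hPXY
  rw [K.curvature_apply hK hX hY, K.nijenhuis_apply hX hY]
  simp only [map_add, map_sub, endo_endo]
  linear_combination (norm := module) (-1 : ℝ) • hXY + (1 : ℝ) • hXKY - (1 : ℝ) • hPXY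

theorem toMap_curvature (K : VForm E N 1) (hK : K.IsProjection) :
    (K.curvature hK).toMap = K.endoMap ∘ K.nijenhuis.toMap :=
  funext fun p ↦ congrArg (TotalSpace.mk' E p.1) (K.curvature_eq_endo_nijenhuis hK p.1 p.2)

end VForm

theorem GroupoidMaps.IsMorphism.comp {A O B P C Q : Type*} {𝒢 : GroupoidMaps A O}
    {ℋ : GroupoidMaps B P} {𝒦 : GroupoidMaps C Q} {F : A → B} {f : O → P} {F' : B → C} {f' : P → Q}
    (h' : ℋ.IsMorphism 𝒦 F' f') (h : 𝒢.IsMorphism ℋ F f) :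
    𝒢.IsMorphism 𝒦 (F' ∘ F) (f' ∘ f) where
  source_comm a := (h'.source_comm _).trans (congrArg f' (h.source_comm a))
  target_comm a := (h'.target_comm _).trans (congrArg f' (h.target_comm a))
  map_mul a b hab := by
    have hFab : ℋ.source (F a) = ℋ.target (F b) := by rw [h.source_comm, h.target_comm, hab]
    exact (congrArg F' (h.map_mul a b hab)).trans (h'.map_mul _ _ hFab)

section TangentSums

variable {E : Type*} [NormedAddCommGroup E] [NormedSpace ℝ E]
  {N : Type*} [TopologicalSpace N] [ChartedSpace E N]
  {E' : Type*} [NormedAddCommGroup E'] [NormedSpace ℝ E']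
  {M : Type*} [TopologicalSpace M] [ChartedSpace E' M]

theorem tangentSum_mk_eq_mk_iff {k : ℕ} {x y : N} {v : Fin k → TangentSpace 𝓘(ℝ, E) x}
    {w : Fin k → TangentSpace 𝓘(ℝ, E) y} :
    (⟨x, v⟩ : Σ x : N, Fin k → TangentSpace 𝓘(ℝ, E) x) = ⟨y, w⟩ ↔
      x = y ∧ ∀ i, (⟨x, v i⟩ : TangentBundle 𝓘(ℝ, E) N) = ⟨y, w i⟩ := by
  constructor
  · intro h
    exact ⟨congrArg Sigma.fst h, fun i ↦ congrArg
      (fun p : Σ x : N, Fin k → TangentSpace 𝓘(ℝ, E) x ↦ TotalSpace.mk' E p.1 (p.2 i)) h⟩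
  · rintro ⟨rfl, h⟩
    exact congrArg (Sigma.mk x) (funext fun i ↦ (tangentBundle_mk_eq_mk_iff.1 (h i)).2)

/-- The map `⊕^k TN → ⊕^k TM` given by the tangent map of `f : N → M` in each component. The
source and target maps of `⊕^k TG ⇉ ⊕^k TM` are of this form. -/
noncomputable def tangentSumMap (f : N → M) {k : ℕ}
    (p : Σ x : N, Fin k → TangentSpace 𝓘(ℝ, E) x) : Σ x : M, Fin k → TangentSpace 𝓘(ℝ, E') x :=
  ⟨f p.1, fun i ↦ mfderiv 𝓘(ℝ, E) 𝓘(ℝ, E') f p.1 (p.2 i)⟩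

end TangentSums

namespace LieGroupoid

variable {E : Type*} [NormedAddCommGroup E] [NormedSpace ℝ E]
  {G : Type*} [TopologicalSpace G] [ChartedSpace E G]
  {E' : Type*} [NormedAddCommGroup E'] [NormedSpace ℝ E']
  {M : Type*} [TopologicalSpace M] [ChartedSpace E' M] {𝒢 : LieGroupoid E G E' M}
  {F : Type*} [NormedAddCommGroup F] [NormedSpace ℝ F]
  {Z : Type*} [TopologicalSpace Z] [ChartedSpace F Z] {φ₁ φ₂ : Z → G} {z : Z}

theorem contMDiffAt_mul (h₁ : ContMDiffAt 𝓘(ℝ, F) 𝓘(ℝ, E) ∞ φ₁ z)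
    (h₂ : ContMDiffAt 𝓘(ℝ, F) 𝓘(ℝ, E) ∞ φ₂ z)
    (hc : ∀ᶠ y in 𝓝 z, 𝒢.source (φ₁ y) = 𝒢.target (φ₂ y)) :
    ContMDiffAt 𝓘(ℝ, F) 𝓘(ℝ, E) ∞ (fun y ↦ 𝒢.mul (φ₁ y) (φ₂ y)) z :=
  (ContMDiffWithinAt.comp (t := 𝒢.composable) z (𝒢.smooth_mul (φ₁ z, φ₂ z) hc.self_of_nhds)
    ((h₁.prodMk h₂).contMDiffWithinAt (s := {y | 𝒢.source (φ₁ y) = 𝒢.target (φ₂ y)}))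
    fun _ hy ↦ hy).contMDiffAt hc

theorem mfderiv_mul (h₁ : MDifferentiableAt 𝓘(ℝ, F) 𝓘(ℝ, E) φ₁ z)
    (h₂ : MDifferentiableAt 𝓘(ℝ, F) 𝓘(ℝ, E) φ₂ z)
    (hc : ∀ᶠ y in 𝓝 z, 𝒢.source (φ₁ y) = 𝒢.target (φ₂ y)) (u : TangentSpace 𝓘(ℝ, F) z) :
    mfderiv 𝓘(ℝ, F) 𝓘(ℝ, E) (fun y ↦ 𝒢.mul (φ₁ y) (φ₂ y)) z u =
      𝒢.tangentMul (φ₁ z) (φ₂ z) (mfderiv 𝓘(ℝ, F) 𝓘(ℝ, E) φ₁ z u)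
        (mfderiv 𝓘(ℝ, F) 𝓘(ℝ, E) φ₂ z u) := by
  have hm := ((𝒢.smooth_mul (φ₁ z, φ₂ z) hc.self_of_nhds).mdifferentiableWithinAt
    (by simp)).hasMFDerivWithinAt
  have h := (HasMFDerivWithinAt.comp (u := 𝒢.composable) z hm
    ((h₁.hasMFDerivAt.prodMk h₂.hasMFDerivAt).hasMFDerivWithinAt
      (s := {y | 𝒢.source (φ₁ y) = 𝒢.target (φ₂ y)})) fun _ hy ↦ hy).hasMFDerivAt hc
  exact DFunLike.congr_fun h.mfderiv u

theorem tangentMap_mul (h₁ : MDifferentiableAt 𝓘(ℝ, F) 𝓘(ℝ, E) φ₁ z)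
    (h₂ : MDifferentiableAt 𝓘(ℝ, F) 𝓘(ℝ, E) φ₂ z)
    (hc : ∀ᶠ y in 𝓝 z, 𝒢.source (φ₁ y) = 𝒢.target (φ₂ y)) (u : TangentSpace 𝓘(ℝ, F) z) :
    tangentMap 𝓘(ℝ, F) 𝓘(ℝ, E) (fun y ↦ 𝒢.mul (φ₁ y) (φ₂ y)) ⟨z, u⟩ =
      𝒢.tangent.mul (tangentMap 𝓘(ℝ, F) 𝓘(ℝ, E) φ₁ ⟨z, u⟩)
        (tangentMap 𝓘(ℝ, F) 𝓘(ℝ, E) φ₂ ⟨z, u⟩) :=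
  congrArg (TotalSpace.mk' E _) (mfderiv_mul h₁ h₂ hc u)

theorem tangentSumMap_mul (h₁ : MDifferentiableAt 𝓘(ℝ, F) 𝓘(ℝ, E) φ₁ z)
    (h₂ : MDifferentiableAt 𝓘(ℝ, F) 𝓘(ℝ, E) φ₂ z)
    (hc : ∀ᶠ y in 𝓝 z, 𝒢.source (φ₁ y) = 𝒢.target (φ₂ y)) {k : ℕ}
    (u : Fin k → TangentSpace 𝓘(ℝ, F) z) :
    tangentSumMap (fun y ↦ 𝒢.mul (φ₁ y) (φ₂ y)) ⟨z, u⟩ =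
      (𝒢.tangentSum k).mul (tangentSumMap φ₁ ⟨z, u⟩) (tangentSumMap φ₂ ⟨z, u⟩) :=
  congrArg (Sigma.mk _) (funext fun i ↦ mfderiv_mul h₁ h₂ hc (u i))

theorem tangent_source_eq_target (h₁ : MDifferentiableAt 𝓘(ℝ, F) 𝓘(ℝ, E) φ₁ z)
    (h₂ : MDifferentiableAt 𝓘(ℝ, F) 𝓘(ℝ, E) φ₂ z)
    (hc : ∀ᶠ y in 𝓝 z, 𝒢.source (φ₁ y) = 𝒢.target (φ₂ y)) (u : TangentSpace 𝓘(ℝ, F) z) :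
    𝒢.tangent.source (tangentMap 𝓘(ℝ, F) 𝓘(ℝ, E) φ₁ ⟨z, u⟩) =
      𝒢.tangent.target (tangentMap 𝓘(ℝ, F) 𝓘(ℝ, E) φ₂ ⟨z, u⟩) := by
  have hs := (𝒢.submersion_source.contMDiff (φ₁ z)).mdifferentiableAt (by simp)
  have ht := (𝒢.submersion_target.contMDiff (φ₂ z)).mdifferentiableAt (by simp)
  have hc' : 𝒢.source ∘ φ₁ =ᶠ[𝓝 z] 𝒢.target ∘ φ₂ := hc
  refine (tangentMap_comp_at ⟨z, u⟩ hs h₁).symm.trans (.trans ?_ (tangentMap_comp_at ⟨z, u⟩ ht h₂))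
  exact tangentBundle_mk_eq_mk_iff.2 ⟨hc.self_of_nhds, DFunLike.congr_fun hc'.mfderiv_eq u⟩

variable [IsManifold 𝓘(ℝ, E) ∞ G] [IsManifold 𝓘(ℝ, E') ∞ M]

theorem isMorphism_endoMap {K : VForm E G 1} {K_M : VForm E' M 1}
    (hK : (𝒢.tangentSum 1).IsMorphism 𝒢.tangent K.toMap K_M.toMap) :
    𝒢.tangent.IsMorphism 𝒢.tangent K.endoMap K_M.endoMap where
  source_comm v := hK.source_comm ⟨v.proj, fun _ ↦ v.2⟩
  target_comm v := hK.target_comm ⟨v.proj, fun _ ↦ v.2⟩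
  map_mul v w hvw := hK.map_mul ⟨v.proj, fun _ ↦ v.2⟩ ⟨w.proj, fun _ ↦ w.2⟩
    (tangentSum_mk_eq_mk_iff.2 ⟨congrArg TotalSpace.proj hvw, fun _ ↦ hvw⟩)

variable {K : VForm E G 1} {K_M : VForm E' M 1}

theorem endoRelatedAt_source (hK : 𝒢.tangent.IsMorphism 𝒢.tangent K.endoMap K_M.endoMap) (g : G) :
    EndoRelatedAt 𝒢.source K.endo K_M.endo g :=
  .of_forall fun g v ↦ (tangentBundle_mk_eq_mk_iff.1 (hK.source_comm ⟨g, v⟩)).2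

theorem endoRelatedAt_target (hK : 𝒢.tangent.IsMorphism 𝒢.tangent K.endoMap K_M.endoMap) (g : G) :
    EndoRelatedAt 𝒢.target K.endo K_M.endo g :=
  .of_forall fun g v ↦ (tangentBundle_mk_eq_mk_iff.1 (hK.target_comm ⟨g, v⟩)).2

theorem endoRelatedAt_mul [IsManifold 𝓘(ℝ, F) 1 Z]
    (hK : 𝒢.tangent.IsMorphism 𝒢.tangent K.endoMap K_M.endoMap)
    {A : ∀ y : Z, TangentSpace 𝓘(ℝ, F) y →L[ℝ] TangentSpace 𝓘(ℝ, F) y}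
    (h₁ : ContMDiffAt 𝓘(ℝ, F) 𝓘(ℝ, E) 1 φ₁ z) (h₂ : ContMDiffAt 𝓘(ℝ, F) 𝓘(ℝ, E) 1 φ₂ z)
    (hc : ∀ᶠ y in 𝓝 z, 𝒢.source (φ₁ y) = 𝒢.target (φ₂ y))
    (hA₁ : EndoRelatedAt φ₁ A K.endo z) (hA₂ : EndoRelatedAt φ₂ A K.endo z) :
    EndoRelatedAt (fun y ↦ 𝒢.mul (φ₁ y) (φ₂ y)) A K.endo z := by
  filter_upwards [eventually_mdifferentiableAt h₁, eventually_mdifferentiableAt h₂,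
    hc.eventually_nhds, hA₁, hA₂] with y h₁ h₂ hc hA₁ hA₂ v
  have endoMap₁ : tangentMap 𝓘(ℝ, F) 𝓘(ℝ, E) φ₁ ⟨y, A y v⟩ =
      K.endoMap (tangentMap 𝓘(ℝ, F) 𝓘(ℝ, E) φ₁ ⟨y, v⟩) := congrArg (TotalSpace.mk' E _) (hA₁ v)
  have endoMap₂ : tangentMap 𝓘(ℝ, F) 𝓘(ℝ, E) φ₂ ⟨y, A y v⟩ =
      K.endoMap (tangentMap 𝓘(ℝ, F) 𝓘(ℝ, E) φ₂ ⟨y, v⟩) := congrArg (TotalSpace.mk' E _) (hA₂ v)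
  have endoMap_mul : tangentMap 𝓘(ℝ, F) 𝓘(ℝ, E) (fun y ↦ 𝒢.mul (φ₁ y) (φ₂ y)) ⟨y, A y v⟩ =
      K.endoMap (tangentMap 𝓘(ℝ, F) 𝓘(ℝ, E) (fun y ↦ 𝒢.mul (φ₁ y) (φ₂ y)) ⟨y, v⟩) := by
    rw [tangentMap_mul h₁ h₂ hc, tangentMap_mul h₁ h₂ hc, endoMap₁, endoMap₂,
      hK.map_mul _ _ (tangent_source_eq_target h₁ h₂ hc v)]
  exact (tangentBundle_mk_eq_mk_iff.1 endoMap_mul).2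

variable [FiniteDimensional ℝ E] [FiniteDimensional ℝ E']

theorem exists_composable_parametrization
    (hK : 𝒢.tangent.IsMorphism 𝒢.tangent K.endoMap K_M.endoMap) {g h : G}
    (hgh : 𝒢.source g = 𝒢.target h) :
    ∃ (S : Submodule ℝ (E × E)) (φ₁ : S → G) (φ₂ : S → G) (A : S → S →L[ℝ] S),
      IsFibreProductParametrization (E' := E') 𝒢.source 𝒢.target K.endo K.endo g h φ₁ φ₂ A :=
  exists_isFibreProductParametrization hgh (𝒢.submersion_source.contMDiff g)
    (𝒢.submersion_target.contMDiff h)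
    (mfderiv_surjective_of_isSubmersionAt (by simp) (𝒢.submersion_source.isSubmersionAt g))
    (endoRelatedAt_source hK g) (endoRelatedAt_target hK h)

end LieGroupoid

section

variable {E : Type*} [NormedAddCommGroup E] [NormedSpace ℝ E] [FiniteDimensional ℝ E]
  {N : Type*} [TopologicalSpace N] [ChartedSpace E N] [IsManifold 𝓘(ℝ, E) ∞ N]

theorem VForm.toMap_nijenhuis_tangentSumMap (K : VForm E N 1) {F : Type*} [NormedAddCommGroup F]
    [NormedSpace ℝ F] {ψ : F → N} {A : F → F →L[ℝ] F} {z : F}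
    (hψ : ContMDiffAt 𝓘(ℝ, F) 𝓘(ℝ, E) ∞ ψ z) (hA : DifferentiableAt ℝ A z)
    (h : EndoRelatedAt ψ A K.endo z) (u : Fin 2 → TangentSpace 𝓘(ℝ, F) z) :
    K.nijenhuis.toMap (tangentSumMap ψ ⟨z, u⟩) =
      tangentMap 𝓘(ℝ, F) 𝓘(ℝ, E) ψ ⟨z, nijenhuisTensor (F := F) A z (u 0) (u 1)⟩ :=
  congrArg (TotalSpace.mk' E _) (K.mfderiv_nijenhuisTensor hψ hA h u).symm

end

namespace LieGroupoid

variable {E : Type*} [NormedAddCommGroup E] [NormedSpace ℝ E]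
  {G : Type*} [TopologicalSpace G] [ChartedSpace E G] [IsManifold 𝓘(ℝ, E) ∞ G]
  {E' : Type*} [NormedAddCommGroup E'] [NormedSpace ℝ E']
  {M : Type*} [TopologicalSpace M] [ChartedSpace E' M] [IsManifold 𝓘(ℝ, E') ∞ M]
  {𝒢 : LieGroupoid E G E' M} {K : VForm E G 1} {K_M : VForm E' M 1}

theorem isProjection_of_isMorphism_endoMap
    (hK : 𝒢.tangent.IsMorphism 𝒢.tangent K.endoMap K_M.endoMap) (hP : K.IsProjection) :
    K_M.IsProjection :=
  hP.of_surjective (f := 𝒢.source) (fun x ↦ ⟨𝒢.one x, 𝒢.source_one x⟩)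
    (fun g ↦ mfderiv_surjective_of_isSubmersionAt (by simp) (𝒢.submersion_source.isSubmersionAt g))
    fun g v ↦ (tangentBundle_mk_eq_mk_iff.1 (hK.source_comm ⟨g, v⟩)).2

variable [FiniteDimensional ℝ E] [FiniteDimensional ℝ E']

theorem toMap_nijenhuis_mul (hK : 𝒢.tangent.IsMorphism 𝒢.tangent K.endoMap K_M.endoMap)
    (p q : Σ g : G, Fin 2 → TangentSpace 𝓘(ℝ, E) g)
    (hpq : (𝒢.tangentSum 2).source p = (𝒢.tangentSum 2).target q) :
    K.nijenhuis.toMap ((𝒢.tangentSum 2).mul p q) =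
      𝒢.tangent.mul (K.nijenhuis.toMap p) (K.nijenhuis.toMap q) := by
  obtain ⟨g, X⟩ := p
  obtain ⟨h, Y⟩ := q
  obtain ⟨hgh, hXY⟩ := tangentSum_mk_eq_mk_iff.1 hpq
  obtain ⟨S, φ₁, φ₂, A, P⟩ := exists_composable_parametrization hK hgh
  choose u hX hY using fun i ↦ P.exists_tangentMap_eq (X i) (Y i) (hXY i)
  obtain rfl := P.map_zero₁
  obtain rfl := P.map_zero₂
  obtain rfl : (fun i ↦ mfderiv 𝓘(ℝ, S) 𝓘(ℝ, E) φ₁ 0 (u i)) = X :=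
    funext fun i ↦ (tangentBundle_mk_eq_mk_iff.1 (hX i)).2
  obtain rfl : (fun i ↦ mfderiv 𝓘(ℝ, S) 𝓘(ℝ, E) φ₂ 0 (u i)) = Y :=
    funext fun i ↦ (tangentBundle_mk_eq_mk_iff.1 (hY i)).2
  have h₁ := P.contMDiffAt₁.of_le (m := 1) (by simp)
  have h₂ := P.contMDiffAt₂.of_le (m := 1) (by simp)
  have d₁ := h₁.mdifferentiableAt one_ne_zero
  have d₂ := h₂.mdifferentiableAt one_ne_zero
  have hψ := contMDiffAt_mul P.contMDiffAt₁ P.contMDiffAt₂ P.eventually_eq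
  have related := endoRelatedAt_mul hK h₁ h₂ P.eventually_eq P.endoRelatedAt₁ P.endoRelatedAt₂
  let n : TangentSpace 𝓘(ℝ, S) (0 : S) := nijenhuisTensor (F := S) A 0 (u 0) (u 1)
  calc K.nijenhuis.toMap ((𝒢.tangentSum 2).mul (tangentSumMap φ₁ ⟨0, u⟩) (tangentSumMap φ₂ ⟨0, u⟩))
    _ = K.nijenhuis.toMap (tangentSumMap (fun z ↦ 𝒢.mul (φ₁ z) (φ₂ z)) ⟨0, u⟩) := by
      rw [tangentSumMap_mul d₁ d₂ P.eventually_eq]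
    _ = tangentMap 𝓘(ℝ, S) 𝓘(ℝ, E) (fun z ↦ 𝒢.mul (φ₁ z) (φ₂ z)) ⟨0, n⟩ :=
      K.toMap_nijenhuis_tangentSumMap hψ P.differentiableAt related u
    _ = 𝒢.tangent.mul (tangentMap 𝓘(ℝ, S) 𝓘(ℝ, E) φ₁ ⟨0, n⟩)
        (tangentMap 𝓘(ℝ, S) 𝓘(ℝ, E) φ₂ ⟨0, n⟩) := tangentMap_mul d₁ d₂ P.eventually_eq n
    _ = 𝒢.tangent.mul (K.nijenhuis.toMap (tangentSumMap φ₁ ⟨0, u⟩))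
        (K.nijenhuis.toMap (tangentSumMap φ₂ ⟨0, u⟩)) := by
      rw [K.toMap_nijenhuis_tangentSumMap P.contMDiffAt₁ P.differentiableAt P.endoRelatedAt₁,
        K.toMap_nijenhuis_tangentSumMap P.contMDiffAt₂ P.differentiableAt P.endoRelatedAt₂]

theorem isMorphism_nijenhuis (hK : 𝒢.tangent.IsMorphism 𝒢.tangent K.endoMap K_M.endoMap) :
    (𝒢.tangentSum 2).IsMorphism 𝒢.tangent K.nijenhuis.toMap K_M.nijenhuis.toMap where
  source_comm p := congrArg (TotalSpace.mk' E' _) <| K.mfderiv_nijenhuis_of_endoRelatedAt K_M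
    (𝒢.submersion_source.contMDiff p.1) (endoRelatedAt_source hK p.1) p.2
  target_comm p := congrArg (TotalSpace.mk' E' _) <| K.mfderiv_nijenhuis_of_endoRelatedAt K_M
    (𝒢.submersion_target.contMDiff p.1) (endoRelatedAt_target hK p.1) p.2
  map_mul := toMap_nijenhuis_mul hK

end LieGroupoid

theorem mainTheorem3
    {E : Type*} [NormedAddCommGroup E] [NormedSpace ℝ E] [FiniteDimensional ℝ E]
    {G : Type*} [TopologicalSpace G] [ChartedSpace E G] [IsManifold 𝓘(ℝ, E) ∞ G]
    {E' : Type*} [NormedAddCommGroup E'] [NormedSpace ℝ E'] [FiniteDimensional ℝ E']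
    {M : Type*} [TopologicalSpace M] [ChartedSpace E' M] [IsManifold 𝓘(ℝ, E') ∞ M]
    (𝒢 : LieGroupoid E G E' M) (K : VForm E G 1) (hK : 𝒢.IsMultiplicative K) :
    𝒢.IsMultiplicative K.nijenhuis ∧
      ∀ hP : K.IsProjection,
        𝒢.IsMultiplicative (K.curvature hP) ∧
          ∀ (g : G) (v : Fin 2 → TangentSpace 𝓘(ℝ, E) g),
            (K.curvature hP).toFun g v = K.endo g (K.nijenhuis.toFun g v) := by
  obtain ⟨K_M, hK⟩ := hK
  have endo_morphism := LieGroupoid.isMorphism_endoMap hK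
  have nijenhuis_morphism := LieGroupoid.isMorphism_nijenhuis endo_morphism
  refine ⟨⟨K_M.nijenhuis, nijenhuis_morphism⟩, fun hP ↦ ⟨?_, K.curvature_eq_endo_nijenhuis hP⟩⟩
  have hP_M := LieGroupoid.isProjection_of_isMorphism_endoMap endo_morphism hP
  refine ⟨K_M.curvature hP_M, ?_⟩
  rw [VForm.toMap_curvature, VForm.toMap_curvature]
  exact endo_morphism.comp nijenhuis_morphism
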